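/- Let $k_1>0$, $k_2,k_3\ge 0$, $s>\frac52$, $u_0\in H^s(\mathbb R)$ real-valued, and put $m_0=u_0-u_{0,xx}$. Consider the Cauchy problem $$m_t+k_1[(u^2-u_x^2)m]_x+k_2(u^2m_x+3uu_xm)+k_3(um_x+2u_xm)=0,\quad m=u-u_{xx},\quad t>0,\ x\in\mathbb R,\qquad u(0,x)=u_0(x).$$ A strong solution on $[0,T)$ is a function $u\in C([0,T);H^s(\mathbb R))\cap C^1([0,T);H^{s-1}(\mathbb R))$ with $u(0)=u_0$ that satisfies the equation, at each time $t\in(0,T)$, in the sense of distributions in $x$. Suppose that $m_0(x)\ge 0$ for all $x\in\mathbb R$, that $x_0\in\mathbb R$ satisfies $m_0(x_0)>0$, and that one of the following four conditions holds. Case 1: $k_2,k_3>0$, and there are $\alpha>2+\frac{4k_1}{3k_2}$ and a choice of the sign in $$\gamma=\frac{(3k_2k_3+4k_1k_3)\pm 2k_3\sqrt{4k_1^2+6k_1k_2}}{3k_2^2}$$ such that $$u_{0,x}(x_0)<-\frac{\alpha}{\sqrt2}\sqrt{\frac{2k_1+3k_2}{2k_1}}\left[u_0(x_0)+\frac{3k_2\gamma+3k_3}{2(2k_1+3k_2)}\right].$$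 Case 2: $k_2=0$, $k_3>0$, and $$u_{0,x}(x_0)<-\frac1{\sqrt2}\left[u_0(x_0)+\frac{3k_3}{4k_1}\right].$$ Case 3: $k_2>0$, $k_3=0$, and $$u_{0,x}(x_0)<-\frac1{\sqrt2}\sqrt{\frac{2k_1+3k_2}{2k_1}}\,u_0(x_0).$$ Case 4: $k_2=k_3=0$, and $$u_{0,x}(x_0)<-\frac1{\sqrt2}\,u_0(x_0).$$ Let $u$ be the strong solution of the Cauchy problem with maximal existence time $T^*\in(0,\infty]$, that is, $u$ is a strong solution on $[0,T^*)$ and cannot be continued to a strong solution on a longer interval. Then $u$ blows up in finite time, that is, $T^*<\infty$, and $$T^*\le-\frac{1}{2k_1\,m_0(x_0)\,u_{0,x}(x_0)}.$$ -/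

import Mathlib

open MeasureTheory Set
open scoped ENNReal SchwartzMap ContDiff

noncomputable section

namespace MCHNovikovCH

/-- The momentum `m = f - f_xx` of a function of the space variable. -/
def momentum (f : ℝ → ℝ) (x : ℝ) : ℝ := f x - deriv (deriv f) x

/-- The real function `f` is (the continuous representative of) an element of the Sobolev
space `H^s(ℝ)`. It is used for `s > 1/2`, where every element of `H^s(ℝ)` has exactly one continuous
representative. -/
def InSobolev (s : ℝ) (f : ℝ → ℝ) : Prop :=
  Continuous f ∧ ∃ h : MemLp (fun x => (f x : ℂ)) 2 (volume : Measure ℝ),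
    TemperedDistribution.MemSobolev s 2 ((h.toLp (fun x => (f x : ℂ)) : Lp ℂ 2 volume) : 𝓢'(ℝ, ℂ))

/-- `f` is the continuous representative of an element of `H^s(ℝ)` whose image under the Bessel
potential operator `J^s` (an isomorphism of `H^s(ℝ)` onto `L²(ℝ)`) is `F`. -/
def HasBesselPotential (s : ℝ) (f : ℝ → ℝ) (F : Lp ℂ 2 (volume : Measure ℝ)) : Prop :=
  Continuous f ∧ ∃ h : MemLp (fun x => (f x : ℂ)) 2 (volume : Measure ℝ),
    TemperedDistribution.besselPotential ℝ ℂ s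
      ((h.toLp (fun x => (f x : ℂ)) : Lp ℂ 2 volume) : 𝓢'(ℝ, ℂ)) = (F : 𝓢'(ℝ, ℂ))

/-- The time interval `[0, T)`, where `T = ∞` is allowed. -/
def timeInterval (T : ℝ≥0∞) : Set ℝ := {t | 0 ≤ t ∧ ENNReal.ofReal t < T}

/-- `u ∈ C([0,T); H^s(ℝ))`. Continuity with values in `H^s` is continuity of `t ↦ J^s u(t)` with
values in `L²`. -/
def ContinuousInSobolev (s : ℝ) (u : ℝ → ℝ → ℝ) (T : ℝ≥0∞) : Prop :=
  ∃ U : ℝ → Lp ℂ 2 (volume : Measure ℝ), ContinuousOn U (timeInterval T) ∧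
    ∀ t ∈ timeInterval T, HasBesselPotential s (u t) (U t)

/-- `u ∈ C¹([0,T); H^s(ℝ))`, the derivative at `t = 0` being one-sided. -/
def ContDiffInSobolev (s : ℝ) (u : ℝ → ℝ → ℝ) (T : ℝ≥0∞) : Prop :=
  ∃ U : ℝ → Lp ℂ 2 (volume : Measure ℝ), ContDiffOn ℝ 1 U (timeInterval T) ∧
    ∀ t ∈ timeInterval T, HasBesselPotential s (u t) (U t)

/-- The equation
`m_t + k₁ [(u² - u_x²) m]_x + k₂ (u² m_x + 3 u u_x m) + k₃ (u m_x + 2 u_x m) = 0`, `m = u - u_xx`,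
at time `t`, in the sense of distributions in `x`. (For `u(t) ∈ H^s` with `5/2 < s ≤ 7/2` the
function `m` is continuous, but `m_x` and `m_t` are only distributions.) Here
`u² m_x + 3 u u_x m = (u² m)_x + u u_x m` and `u m_x + 2 u_x m = (u m)_x + u_x m`. -/
def SatisfiesEquationAt (k₁ k₂ k₃ : ℝ) (u : ℝ → ℝ → ℝ) (t : ℝ) : Prop :=
  ∀ φ : ℝ → ℝ, ContDiff ℝ ∞ φ → HasCompactSupport φ →
    (∫ x, deriv (fun τ => u τ x) t * (φ x - deriv (deriv φ) x))
      - k₁ * (∫ x, (u t x ^ 2 - deriv (u t) x ^ 2) * momentum (u t) x * deriv φ x)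
      + k₂ * (∫ x, (u t x * deriv (u t) x * momentum (u t) x * φ x
          - u t x ^ 2 * momentum (u t) x * deriv φ x))
      + k₃ * (∫ x, (deriv (u t) x * momentum (u t) x * φ x
          - u t x * momentum (u t) x * deriv φ x)) = 0

/-- `u` (written `u t x`) is a strong solution on `[0, T)` of the Cauchy problem with initial
value `u₀`, in the class `C([0,T); H^s) ∩ C¹([0,T); H^(s-1))`. -/
structure IsStrongSolution (k₁ k₂ k₃ s : ℝ) (u₀ : ℝ → ℝ) (u : ℝ → ℝ → ℝ) (T : ℝ≥0∞) : Prop where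
  pos : 0 < T
  initial : u 0 = u₀
  continuous : ContinuousInSobolev s u T
  contDiff : ContDiffInSobolev (s - 1) u T
  equation : ∀ t ∈ timeInterval T, 0 < t → SatisfiesEquationAt k₁ k₂ k₃ u t

/-- `u` is a strong solution with maximal existence time `T`: it cannot be continued, as a strong
solution, to a longer interval. -/
def IsMaximalSolution (k₁ k₂ k₃ s : ℝ) (u₀ : ℝ → ℝ) (u : ℝ → ℝ → ℝ) (T : ℝ≥0∞) : Prop :=
  IsStrongSolution k₁ k₂ k₃ s u₀ u T ∧
    ∀ (T' : ℝ≥0∞) (v : ℝ → ℝ → ℝ), T < T' → IsStrongSolution k₁ k₂ k₃ s u₀ v T' →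
      ¬ ∀ t ∈ timeInterval T, v t = u t

end MCHNovikovCH

end

/-!
The solution is followed along the characteristic `q' = V(t, q)`, `q(0) = x₀`, where
`V = k₁ (u² - u_x²) + k₂ u² + k₃ u`. With `h = k₂ u u_x + k₃ u_x` the equation reads
`m_t + (V m)_x + h m = 0`, and along the characteristic
`m' = -(2 k₁ u_x m + 3 k₂ u u_x + 2 k₃ u_x) m`. Hence `m` stays nonnegative, `|u_x| ≤ u`, and if
`u_x` never exceeds its initial value `u_{0,x}(x₀) < 0` on the characteristic, then
`(1 / m)' ≤ 2 k₁ u_{0,x}(x₀)`, so that `1 / m` would vanish no later than at the asserted time.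

That `u_x` decreases is the main point. All four slope conditions imply
`u_{0,x} < -κ (u₀ + c)` at `x₀`, where `κ² = (2 k₁ + 3 k₂) / (4 k₁)` and
`c = 3 k₃ / (2 (2 k₁ + 3 k₂))`; in the first of them `α ≥ 1` and `γ ≥ 0` suffice for this. (As
`|u_x| ≤ u`, such a slope occurs only for `κ < 1`; the factor `α > 2` of the first condition makes
that condition more restrictive than `|u_x| ≤ u` permits. The argument covers it like the others.)
The inequality `u_x ≤ -K (u + c)`, `K > κ`, propagates along the characteristic, and it makes
`u_x` decrease. Both facts rest on upper bounds for the growth of `u_x + u` and of `u_x - u` along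
characteristics (`IsClassicalSolution.deriv_add_le`,
`IsClassicalSolution.neg_growth_le_deriv_sub`), combined in the elementary inequality
`concave_form_pos`. The bounds replace the usual estimates of convolutions with `e^{-|x|} / 2`:
the equation gives `(e^{-x} (u_t + u_tx - V m))_x = e^{-x} (V + h) m`, and a polynomial
`Q(u, u_x)` is chosen with `(e^{-x} Q)_x + e^{-x} (V + h) m ≥ 0`; then
`e^{-x} (u_t + u_tx - V m + Q)` increases to its limit `0` at infinity, and is therefore nonpositive.

For `s > 5/2` the momentum is continuous, but it need not be differentiable. Since
`u ∈ C([0,T); H^s) ∩ C¹([0,T); H^(s-1))`, the functions `u`, `u_x`, `u_xx`, `u_t`, `u_tx`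
are continuous and bounded in space by the Sobolev embedding, which is proved with the Fourier
inversion integral (`HasBesselPotential.eq_besselEval`); by the lemma of du Bois-Reymond the
equation holds in the integrated form `(u_tx - V m)_x = u_t + h m`
(`SatisfiesEquationAt.hasDerivAt`). The evolution of `m` is obtained for its averages over
`[q, q + ε]`, which are difference quotients of `e^{-x} (u + u_x)`, and passes to the limit
(`IsClassicalSolution.exp_neg_mul_momentum_eq`).
-/

noncomputable section

namespace MCHNovikovCH

open FourierTransform Filter Topology

/-! ### Sobolev embedding -/

/-- The Fourier symbol of `∂ₓ^j (J^σ)⁻¹`. -/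
def besselSymbol (σ : ℝ) (j : ℕ) (ξ : ℝ) : ℂ :=
  (2 * Real.pi * Complex.I * ξ) ^ j * ((1 + ‖ξ‖ ^ 2) ^ (-σ / 2) : ℝ)

theorem continuous_besselSymbol (σ : ℝ) (j : ℕ) : Continuous (besselSymbol σ j) := by
  unfold besselSymbol
  refine Continuous.mul (by fun_prop) (Complex.continuous_ofReal.comp ?_)
  refine Continuous.rpow_const (by fun_prop) fun x => Or.inl (by positivity)

theorem besselSymbol_succ (σ : ℝ) (j : ℕ) (ξ : ℝ) :
    besselSymbol σ (j + 1) ξ = (2 * Real.pi * Complex.I * ξ) * besselSymbol σ j ξ := by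
  simp only [besselSymbol]; ring

theorem norm_besselSymbol_le (σ : ℝ) (j : ℕ) (ξ : ℝ) :
    ‖besselSymbol σ j ξ‖ ≤ (2 * Real.pi) ^ j * (1 + ‖ξ‖ ^ 2) ^ (-(σ - j) / 2) := by
  have h1 : (0 : ℝ) < 1 + ‖ξ‖ ^ 2 := by positivity
  have h2 : ‖ξ‖ ^ j ≤ (1 + ‖ξ‖ ^ 2) ^ ((j : ℝ) / 2) := by
    have : ‖ξ‖ ^ j = (‖ξ‖ ^ 2) ^ ((j : ℝ) / 2) := by
      rw [← Real.rpow_natCast_mul (norm_nonneg _), ← Real.rpow_natCast]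
      congr 1; push_cast; ring
    rw [this]
    exact Real.rpow_le_rpow (by positivity) (by linarith) (by positivity)
  have h3 : (1 + ‖ξ‖ ^ 2) ^ (-(σ - j) / 2)
      = (1 + ‖ξ‖ ^ 2) ^ ((j : ℝ) / 2) * (1 + ‖ξ‖ ^ 2) ^ (-σ / 2) := by
    rw [← Real.rpow_add h1]; congr 1; ring
  have h4 : ‖besselSymbol σ j ξ‖ = (2 * Real.pi) ^ j * (‖ξ‖ ^ j * (1 + ‖ξ‖ ^ 2) ^ (-σ / 2)) := by
    rw [besselSymbol, norm_mul, norm_pow, Complex.norm_real,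
      Real.norm_of_nonneg (Real.rpow_nonneg h1.le _), ← mul_assoc, ← mul_pow]
    congr 2
    simp [abs_of_pos Real.pi_pos]
  rw [h4, h3]
  gcongr

theorem memLp_besselSymbol {σ : ℝ} {j : ℕ} (h : j + 1 / 2 < σ) :
    MemLp (besselSymbol σ j) 2 (volume : Measure ℝ) := by
  have hint : Integrable (fun ξ : ℝ => (1 + ‖ξ‖ ^ 2) ^ (-(2 * (σ - j)) / 2)) :=
    integrable_rpow_neg_one_add_norm_sq (by simp; linarith)
  have hbase : MemLp (fun ξ : ℝ => (2 * Real.pi) ^ j * (1 + ‖ξ‖ ^ 2) ^ (-(σ - j) / 2)) 2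
      (volume : Measure ℝ) := by
    refine MemLp.const_mul ?_ _
    refine (memLp_two_iff_integrable_sq ?_).2 ?_
    · refine (Continuous.rpow_const (by fun_prop) fun x => Or.inl (by positivity))
        |>.aestronglyMeasurable
    · refine hint.congr (Eventually.of_forall fun ξ => ?_)
      simp only
      rw [← Real.rpow_mul_natCast (by positivity)]
      congr 1; push_cast; ring
  exact hbase.mono' (continuous_besselSymbol σ j).aestronglyMeasurable
    (Eventually.of_forall (norm_besselSymbol_le σ j))

/-- The Fourier transform of `∂ₓ^j (J^σ)⁻¹ F`. -/
def besselFourier (σ : ℝ) (j : ℕ) (F : Lp ℂ 2 (volume : Measure ℝ)) (ξ : ℝ) : ℂ :=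
  besselSymbol σ j ξ * (𝓕 F : Lp ℂ 2 (volume : Measure ℝ)) ξ

theorem integrable_besselFourier {σ : ℝ} {j : ℕ} (h : j + 1 / 2 < σ)
    (F : Lp ℂ 2 (volume : Measure ℝ)) : Integrable (besselFourier σ j F) := by
  exact (memLp_besselSymbol h).integrable_mul (Lp.memLp (𝓕 F : Lp ℂ 2 (volume : Measure ℝ)))

theorem besselFourier_succ (σ : ℝ) (j : ℕ) (F : Lp ℂ 2 (volume : Measure ℝ)) (ξ : ℝ) :
    besselFourier σ (j + 1) F ξ = (2 * Real.pi * Complex.I * ξ) * besselFourier σ j F ξ := by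
  rw [besselFourier, besselFourier, besselSymbol_succ]; ring

/-- The value at `x` of `∂ₓ^j (J^σ)⁻¹ F`, given by the Fourier inversion integral. -/
def besselEval (σ : ℝ) (j : ℕ) (F : Lp ℂ 2 (volume : Measure ℝ)) (x : ℝ) : ℂ :=
  𝓕⁻ (besselFourier σ j F) x

theorem besselEval_eq (σ : ℝ) (j : ℕ) (F : Lp ℂ 2 (volume : Measure ℝ)) (x : ℝ) :
    besselEval σ j F x = 𝓕 (besselFourier σ j F) (-x) :=
  Real.fourierInv_eq_fourier_neg _ _

theorem continuous_besselEval {σ : ℝ} {j : ℕ} (h : j + 1 / 2 < σ)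
    (F : Lp ℂ 2 (volume : Measure ℝ)) : Continuous (besselEval σ j F) := by
  have : Continuous (𝓕 (besselFourier σ j F)) :=
    VectorFourier.fourierIntegral_continuous Real.continuous_fourierChar
      (by exact continuous_inner) (integrable_besselFourier h F)
  rw [show besselEval σ j F = fun x => 𝓕 (besselFourier σ j F) (-x) from
    funext (besselEval_eq σ j F)]
  exact this.comp continuous_neg

theorem hasDerivAt_besselEval {σ : ℝ} {j : ℕ} (h : j + 3 / 2 < σ)
    (F : Lp ℂ 2 (volume : Measure ℝ)) (x : ℝ) :
    HasDerivAt (besselEval σ j F) (besselEval σ (j + 1) F x) x := by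
  have h1 := integrable_besselFourier (σ := σ) (j := j) (by linarith) F
  have h2 := integrable_besselFourier (σ := σ) (j := j + 1) (by push_cast; linarith) F
  have hc : (2 * Real.pi * Complex.I : ℂ) ≠ 0 := by
    simp [Real.pi_ne_zero]
  have h3 : Integrable (fun ξ : ℝ => ξ • besselFourier σ j F ξ) := by
    have := h2.const_mul ((2 * Real.pi * Complex.I : ℂ)⁻¹)
    refine this.congr (Eventually.of_forall fun ξ => ?_)
    simp only [besselFourier_succ, Complex.real_smul]
    field_simp
  have h4 := (Real.hasDerivAt_fourier h1 h3 (-x)).scomp x (hasDerivAt_neg x)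
  rw [show besselEval σ j F = 𝓕 (besselFourier σ j F) ∘ Neg.neg from
    funext (besselEval_eq σ j F)]
  convert! h4 using 1
  rw [besselEval_eq, Real.fourier_eq, Real.fourier_eq, ← integral_smul]
  congr 1
  ext ξ
  rw [besselFourier_succ]
  simp only [smul_eq_mul, Circle.smul_def]
  simp

theorem norm_besselEval_le (σ : ℝ) (j : ℕ) (F : Lp ℂ 2 (volume : Measure ℝ)) (x : ℝ)
    (h : j + 1 / 2 < σ) :
    ‖besselEval σ j F x‖ ≤ ‖(memLp_besselSymbol h).toLp‖ * ‖F‖ := by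
  rw [besselEval_eq]
  refine (VectorFourier.norm_fourierIntegral_le_integral_norm _ _ _ _ _).trans ?_
  set S : Lp ℂ 2 (volume : Measure ℝ) := (memLp_besselSymbol h).toLp with hS
  set G : Lp ℂ 2 (volume : Measure ℝ) := 𝓕 F with hG
  have hnG : ‖G‖ = ‖F‖ := Lp.norm_fourier_eq F
  rw [← hnG]
  have hSm : MemLp (fun ξ => ‖besselSymbol σ j ξ‖) (ENNReal.ofReal 2) (volume : Measure ℝ) := by
    simpa using (memLp_besselSymbol h).norm
  have hGm : MemLp (fun ξ => ‖G ξ‖) (ENNReal.ofReal 2) (volume : Measure ℝ) := by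
    simpa using (Lp.memLp G).norm
  have := integral_mul_le_Lp_mul_Lq_of_nonneg (μ := volume) Real.HolderConjugate.two_two
    (Eventually.of_forall fun ξ => norm_nonneg (besselSymbol σ j ξ))
    (Eventually.of_forall fun ξ => norm_nonneg (G ξ)) hSm hGm
  calc _ = ∫ ξ, ‖besselSymbol σ j ξ‖ * ‖G ξ‖ := by
        congr 1; ext ξ; rw [besselFourier, norm_mul]
    _ ≤ _ := this
    _ = _ := by
      have key : ∀ (f : ℝ → ℂ) (hf : MemLp f 2 (volume : Measure ℝ)),
          (∫ ξ, ‖f ξ‖ ^ (2 : ℝ)) ^ (1 / 2 : ℝ) = ‖hf.toLp f‖ := by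
        intro f hf
        rw [Lp.norm_toLp, hf.eLpNorm_eq_integral_rpow_norm (by norm_num) (by norm_num),
          ENNReal.toReal_ofReal (Real.rpow_nonneg (integral_nonneg fun _ => by positivity) _)]
        norm_num
      rw [key _ (memLp_besselSymbol h), key _ (Lp.memLp G), Lp.toLp_coeFn]

/-- Evaluation at `x` of the real part of `∂ₓ^j (J^σ)⁻¹ F`, a continuous linear functional of
`F ∈ L²` as soon as `σ > j + 1/2`. -/
def besselEvalCLM {σ : ℝ} {j : ℕ} (h : j + 1 / 2 < σ) (x : ℝ) :
    Lp ℂ 2 (volume : Measure ℝ) →L[ℝ] ℝ :=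
  LinearMap.mkContinuous
    { toFun := fun F => (besselEval σ j F x).re
      map_add' := fun F G => by
        rw [← Complex.add_re]
        congr 1
        simp only [besselEval_eq]
        rw [Real.fourier_congr_ae (f₂ := besselFourier σ j F + besselFourier σ j G)]
        · have := VectorFourier.fourierIntegral_add Real.continuous_fourierChar
            (L := innerₗ ℝ) (by exact continuous_inner) (integrable_besselFourier h F)
            (integrable_besselFourier h G)
          exact congrFun this (-x)
        · have : (𝓕 (F + G) : Lp ℂ 2 (volume : Measure ℝ)) = 𝓕 F + 𝓕 G :=
            fourier_add F G
          simp only [Filter.EventuallyEq, besselFourier, this]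
          filter_upwards [Lp.coeFn_add (𝓕 F : Lp ℂ 2 (volume : Measure ℝ)) (𝓕 G)] with ξ hξ
          simp only [hξ, Pi.add_apply, besselFourier, mul_add]
      map_smul' := fun c F => by
        have e : (besselEval σ j (c • F) x) = (c : ℂ) • besselEval σ j F x := by
          simp only [besselEval_eq]
          rw [Real.fourier_congr_ae (f₂ := (c : ℂ) • besselFourier σ j F)]
          · exact congrFun (VectorFourier.fourierIntegral_const_smul _ _ _ _ _) (-x)
          · have : (𝓕 (c • F) : Lp ℂ 2 (volume : Measure ℝ)) = (c : ℂ) • 𝓕 F := by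
              rw [← fourier_smul]; rfl
            simp only [Filter.EventuallyEq, besselFourier, this]
            filter_upwards [Lp.coeFn_smul (c : ℂ) (𝓕 F : Lp ℂ 2 (volume : Measure ℝ))] with ξ hξ
            simp only [hξ, Pi.smul_apply, besselFourier, smul_eq_mul]
            ring
        rw [e]; simp }
    ‖(memLp_besselSymbol h).toLp‖ fun F =>
      (Complex.abs_re_le_norm _).trans (norm_besselEval_le σ j F x h)

@[simp]
theorem besselEvalCLM_apply {σ : ℝ} {j : ℕ} (h : j + 1 / 2 < σ) (x : ℝ)
    (F : Lp ℂ 2 (volume : Measure ℝ)) : besselEvalCLM h x F = (besselEval σ j F x).re := rfl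

theorem norm_besselEvalCLM_le {σ : ℝ} {j : ℕ} (h : j + 1 / 2 < σ) (x : ℝ) :
    ‖besselEvalCLM h x‖ ≤ ‖(memLp_besselSymbol h).toLp‖ :=
  LinearMap.mkContinuous_norm_le _ (norm_nonneg _) _

theorem continuous_besselEvalCLM {σ : ℝ} {j : ℕ} (h : j + 1 / 2 < σ)
    (F : Lp ℂ 2 (volume : Measure ℝ)) : Continuous fun x => besselEvalCLM h x F :=
  Complex.continuous_re.comp (continuous_besselEval h F)

theorem hasDerivAt_besselEvalCLM {σ : ℝ} {j : ℕ} (h : j + 1 / 2 < σ)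
    (h' : (j + 1 : ℕ) + 1 / 2 < σ) (F : Lp ℂ 2 (volume : Measure ℝ)) (x : ℝ) :
    HasDerivAt (fun x => besselEvalCLM h x F) (besselEvalCLM h' x F) x :=
  Complex.reCLM.hasFDerivAt.comp_hasDerivAt x
    (hasDerivAt_besselEval (by push_cast at h'; linarith) F x)

/-- Sobolev embedding: the continuous representative of `(J^σ)⁻¹ F` is given by the Fourier
inversion integral. Both sides are the same tempered distribution, by Fubini's theorem. -/
theorem HasBesselPotential.eq_besselEval {σ : ℝ} {f : ℝ → ℝ} {F : Lp ℂ 2 (volume : Measure ℝ)}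
    (hf : HasBesselPotential σ f F) (h : 1 / 2 < σ) (x : ℝ) :
    (f x : ℂ) = besselEval σ 0 F x := by
  obtain ⟨hc, hL, hJ⟩ := hf
  have h0 : ((0 : ℕ) : ℝ) + 1 / 2 < σ := by simpa using h
  have hJ' := (TemperedDistribution.besselPotential_neg_apply_eq_iff σ _ _).2 hJ
  have hcc : Continuous (fun x => (f x : ℂ)) := Complex.continuous_ofReal.comp hc
  have hce := continuous_besselEval h0 F
  suffices hae : (fun x => (f x : ℂ)) =ᵐ[volume] besselEval σ 0 F from
    congrFun ((Continuous.ae_eq_iff_eq volume hcc hce).1 hae) x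
  refine ae_eq_of_integral_contDiff_smul_eq hcc.locallyIntegrable hce.locallyIntegrable ?_
  intro g hg hgc
  have hg₁ : HasCompactSupport (Complex.ofRealCLM ∘ g) := hgc.comp_left rfl
  have hg₂ : ContDiff ℝ ∞ (Complex.ofRealCLM ∘ g) := by fun_prop
  set φ : 𝓢(ℝ, ℂ) := hg₁.toSchwartzMap hg₂ with hφ
  have hφa : ∀ x, φ x = (g x : ℂ) := fun x => rfl
  have e1 : ∫ x, g x • (f x : ℂ) = ((hL.toLp _ : Lp ℂ 2 volume) : 𝓢'(ℝ, ℂ)) φ := by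
    rw [Lp.toTemperedDistribution_apply]
    refine integral_congr_ae ?_
    filter_upwards [hL.coeFn_toLp] with x hx
    rw [hx, hφa]; simp
  rw [e1, ← hJ', TemperedDistribution.besselPotential,
    TemperedDistribution.fourierMultiplierCLM_apply, TemperedDistribution.fourierInv_apply,
    TemperedDistribution.smulLeftCLM_apply_apply, Lp.fourier_toTemperedDistribution_eq,
    Lp.toTemperedDistribution_apply]
  have hfub := VectorFourier.integral_fourierIntegral_smul_eq_flip (μ := volume) (ν := volume)
    (L := -(innerₗ ℝ)) (f := (φ : ℝ → ℂ)) (g := besselFourier σ 0 F)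
    Real.continuous_fourierChar
      (by simpa using (by fun_prop : Continuous fun p : ℝ × ℝ => -(p.2 * p.1)))
    φ.integrable (integrable_besselFourier h0 F)
  have hw : (fun x : ℝ => (((1 + ‖x‖ ^ 2) ^ (-σ / 2) : ℝ) : ℂ)).HasTemperateGrowth := by
    fun_prop
  have e2 : ∀ x, besselEval σ 0 F x
      = VectorFourier.fourierIntegral Real.fourierChar volume
        (-(innerₗ ℝ) : ℝ →ₗ[ℝ] ℝ →ₗ[ℝ] ℝ).flip
        (besselFourier σ 0 F) x := by
    intro x
    rw [besselEval, Real.fourierInv_eq, VectorFourier.fourierIntegral]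
    congr 1; ext v
    simp [mul_comm]
  calc _ = _ := ?_
    _ = _ := hfub
    _ = _ := ?_
  · congr 1; ext ξ
    have e3 : (𝓕⁻ φ) ξ
        = VectorFourier.fourierIntegral Real.fourierChar volume (-(innerₗ ℝ)) (φ : ℝ → ℂ) ξ := by
      rw [SchwartzMap.fourierInv_coe, Real.fourierInv_eq, VectorFourier.fourierIntegral]
      congr 1; ext v
      simp
    rw [SchwartzMap.smulLeftCLM_apply_apply hw, e3, besselFourier, besselSymbol]
    simp only [smul_eq_mul]
    ring
  · congr 1; ext x
    rw [e2, hφa]; simp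

/-! ### Calculus on the line -/

theorem tendsto_exp_neg_mul_of_abs_le {f : ℝ → ℝ} {C : ℝ} (hC : ∀ x, |f x| ≤ C) :
    Tendsto (fun x => Real.exp (-x) * f x) atTop (𝓝 0) := by
  have h : Tendsto (fun x : ℝ => Real.exp (-x) * C) atTop (𝓝 0) := by
    simpa using Real.tendsto_exp_neg_atTop_nhds_zero.mul_const C
  refine squeeze_zero_norm (fun x => ?_) h
  rw [norm_mul, Real.norm_of_nonneg (Real.exp_nonneg _), Real.norm_eq_abs]
  exact mul_le_mul_of_nonneg_left (hC x) (Real.exp_nonneg _)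

theorem hasDerivAt_exp_neg_mul {f f' : ℝ → ℝ} (hf : ∀ x, HasDerivAt f (f' x) x) (x : ℝ) :
    HasDerivAt (fun x => Real.exp (-x) * f x) (Real.exp (-x) * (f' x - f x)) x := by
  have := ((hasDerivAt_neg x).exp).mul (hf x)
  convert! this using 1
  ring

/-- A bounded subsolution of `f' = f` is nonnegative, since `e^{-x} f` decreases to `0`. -/
theorem nonneg_of_deriv_le_self {f f' : ℝ → ℝ} {C : ℝ} (hf : ∀ x, HasDerivAt f (f' x) x)
    (hC : ∀ x, |f x| ≤ C) (h : ∀ x, f' x ≤ f x) (x : ℝ) : 0 ≤ f x := by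
  have hanti : Antitone fun x => Real.exp (-x) * f x := by
    refine antitone_of_deriv_nonpos (fun x => (hasDerivAt_exp_neg_mul hf x).differentiableAt)
      fun x => ?_
    rw [(hasDerivAt_exp_neg_mul hf x).deriv]
    exact mul_nonpos_of_nonneg_of_nonpos (Real.exp_nonneg _) (sub_nonpos.2 (h x))
  have h0 : 0 ≤ Real.exp (-x) * f x :=
    hanti.le_of_tendsto (tendsto_exp_neg_mul_of_abs_le hC) x
  exact nonneg_of_mul_nonneg_right h0 (Real.exp_pos _)

theorem pos_of_deriv_lt_self {f f' : ℝ → ℝ} {C : ℝ} (hf : ∀ x, HasDerivAt f (f' x) x)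
    (hC : ∀ x, |f x| ≤ C) (h : ∀ x, f' x ≤ f x) {x : ℝ} (hx : f' x < f x) : 0 < f x := by
  have hnn := nonneg_of_deriv_le_self hf hC h
  refine lt_of_le_of_ne (hnn x) fun h0 => ?_
  have hmin : IsLocalMin f x := Eventually.of_forall fun y => h0 ▸ hnn y
  rw [hmin.hasDerivAt_eq_zero (hf x), ← h0] at hx
  exact lt_irrefl _ hx

theorem nonneg_of_neg_self_le_deriv {f f' : ℝ → ℝ} {C : ℝ} (hf : ∀ x, HasDerivAt f (f' x) x)
    (hC : ∀ x, |f x| ≤ C) (h : ∀ x, -f x ≤ f' x) (x : ℝ) : 0 ≤ f x := by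
  have := nonneg_of_deriv_le_self (f := fun x => f (-x)) (f' := fun x => -f' (-x))
    (fun x => by simpa [Function.comp_def] using (hf (-x)).scomp x (hasDerivAt_neg x))
    (fun x => hC (-x))
    (fun x => by have := h (-x); linarith) (-x)
  simpa using this

theorem pos_of_neg_self_lt_deriv {f f' : ℝ → ℝ} {C : ℝ} (hf : ∀ x, HasDerivAt f (f' x) x)
    (hC : ∀ x, |f x| ≤ C) (h : ∀ x, -f x ≤ f' x) {x : ℝ} (hx : -f x < f' x) : 0 < f x := by
  have := pos_of_deriv_lt_self (f := fun x => f (-x)) (f' := fun x => -f' (-x))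
    (fun x => by simpa [Function.comp_def] using (hf (-x)).scomp x (hasDerivAt_neg x))
    (fun x => hC (-x))
    (fun x => by have := h (-x); linarith) (x := -x) (by simp; linarith)
  simpa using this

/-- The solution formula for a scalar linear differential equation. -/
theorem eq_mul_exp_of_hasDerivAt_mul {M c : ℝ → ℝ} {τ : ℝ} (hM : Continuous M)
    (hc : Continuous c) (h : ∀ t ∈ Ioo 0 τ, HasDerivAt M (c t * M t) t) {t : ℝ}
    (ht : t ∈ Icc 0 τ) : M t = M 0 * Real.exp (∫ s in (0 : ℝ)..t, c s) := by
  set I : ℝ → ℝ := fun t => ∫ s in (0 : ℝ)..t, c s with hI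
  have hId : ∀ t, HasDerivAt I (c t) t := fun t => hc.integral_hasStrictDerivAt 0 t |>.hasDerivAt
  have hIc : Continuous I := continuous_iff_continuousAt.2 fun t => (hId t).continuousAt
  set g : ℝ → ℝ := fun t => M t * Real.exp (-I t) with hg
  have hgd : ∀ s ∈ Ioo 0 τ, HasDerivAt g 0 s := fun s hs => by
    have := (h s hs).mul ((hId s).neg.exp)
    convert! this using 1
    ring
  have hconst : g t = g 0 := by
    have := intervalIntegral.integral_eq_sub_of_hasDerivAt_of_le (f := g) (f' := fun _ => 0) ht.1
      (by fun_prop) (fun s hs => hgd s ⟨hs.1, hs.2.trans_le ht.2⟩) (by simp)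
    simp only [intervalIntegral.integral_zero] at this
    linarith
  have h0 : I 0 = 0 := by simp [hI]
  simp only [hg, h0, neg_zero, Real.exp_zero, mul_one] at hconst
  rw [← hconst, mul_assoc, ← Real.exp_add]
  simp [hI]

/-- A bounded, globally Lipschitz vector field has an integral curve through every point, on the
whole time interval. -/
theorem exists_integralCurve {V : ℝ → ℝ → ℝ} {τ : ℝ} {L K : NNReal}
    (hV : ∀ x, Continuous fun t => V t x) (hL : ∀ t x, |V t x| ≤ L)
    (hK : ∀ t, LipschitzWith K (V t)) {t₀ : ℝ} (ht₀ : t₀ ∈ Icc 0 τ) (x₀ : ℝ) :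
    ∃ q : ℝ → ℝ, Continuous q ∧ q t₀ = x₀ ∧ ∀ t ∈ Ioo 0 τ, HasDerivAt q (V t (q t)) t := by
  have hτ : 0 ≤ τ := ht₀.1.trans ht₀.2
  have hPL : IsPicardLindelof V (⟨t₀, ht₀⟩ : Icc 0 τ) x₀ (L * τ.toNNReal) 0 L K :=
    { lipschitzOnWith := fun t _ => (hK t).lipschitzOnWith
      continuousOn := fun x _ => (hV x).continuousOn
      norm_le := fun t _ x _ => hL t x
      mul_max_le := by
        have h1 : max (τ - t₀) (t₀ - 0) ≤ τ := by
          rw [max_le_iff]; constructor <;> linarith [ht₀.1, ht₀.2]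
        simpa [Real.coe_toNNReal _ hτ] using mul_le_mul_of_nonneg_left h1 L.2 }
  obtain ⟨α, hα0, hα⟩ := hPL.exists_eq_forall_mem_Icc_hasDerivWithinAt₀
  have hαc : ContinuousOn α (Icc 0 τ) := fun t ht => (hα t ht).continuousWithinAt
  refine ⟨IccExtend hτ ((Icc 0 τ).domRestrict α), ?_, ?_, fun t ht => ?_⟩
  · exact (continuousOn_iff_continuous_domRestrict.1 hαc).Icc_extend'
  · rw [IccExtend_of_mem _ _ ht₀]; exact hα0
  · have hmem := Ioo_subset_Icc_self ht
    rw [IccExtend_of_mem _ _ hmem]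
    refine ((hα t hmem).hasDerivAt (Icc_mem_nhds ht.1 ht.2)).congr_of_eventuallyEq ?_
    filter_upwards [Icc_mem_nhds ht.1 ht.2] with s hs
    rw [IccExtend_of_mem _ _ hs]; rfl

/-! ### Solutions in classical form -/

/-- The speed `k₁ (u² - u_x²) + k₂ u² + k₃ u` of the characteristics, as a function of the values
`a` of `u` and `b` of `u_x`. -/
def speed (k₁ k₂ k₃ a b : ℝ) : ℝ := k₁ * (a ^ 2 - b ^ 2) + k₂ * a ^ 2 + k₃ * a

/-- The coefficient `k₂ u u_x + k₃ u_x` in the form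
`m_t + (V m)_x + (k₂ u u_x + k₃ u_x) m = 0` of the equation, where `V` is the speed; `a` and `b`
are the values of `u` and `u_x`. -/
def damping (k₂ k₃ a b : ℝ) : ℝ := k₂ * a * b + k₃ * b

/-- The regularity that a solution of class `C([0,T); H^s) ∩ C¹([0,T); H^(s-1))`, `s > 5/2`, has on
`[0, τ]`, `τ < T`, together with the equation integrated once in space. The functions `ux`, `ut`,
`utx` are the derivatives of `u`, and `m` is the momentum. The equation `m_t + (V m)_x + h m = 0`
reads `(u_tx - V m)_x = u_t + h m`, where `u_tx - V m` is differentiable although neither of its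
terms needs to be. Times outside `[0, τ]` only serve to have total functions. -/
structure IsClassicalSolution (k₁ k₂ k₃ τ : ℝ) (u ux m ut utx : ℝ → ℝ → ℝ) : Prop where
  continuous_u : Continuous fun p : ℝ × ℝ => u p.1 p.2
  continuous_ux : Continuous fun p : ℝ × ℝ => ux p.1 p.2
  continuous_m : Continuous fun p : ℝ × ℝ => m p.1 p.2
  bounded : ∃ C, ∀ t x, |u t x| ≤ C ∧ |ux t x| ≤ C ∧ |m t x| ≤ C
  hasDerivAt_u : ∀ t x, HasDerivAt (u t) (ux t x) x
  hasDerivAt_ux : ∀ t x, HasDerivAt (ux t) (u t x - m t x) x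
  bounded_ut : ∀ t, ∃ C, ∀ x, |ut t x| ≤ C ∧ |utx t x| ≤ C
  hasDerivAt_ut : ∀ t x, HasDerivAt (ut t) (utx t x) x
  along_u : ∀ t ∈ Ioo 0 τ, ∀ (q : ℝ → ℝ) (v : ℝ), HasDerivAt q v t →
    HasDerivAt (fun s => u s (q s)) (ut t (q t) + ux t (q t) * v) t
  along_ux : ∀ t ∈ Ioo 0 τ, ∀ (q : ℝ → ℝ) (v : ℝ), HasDerivAt q v t →
    HasDerivAt (fun s => ux s (q s)) (utx t (q t) + (u t (q t) - m t (q t)) * v) t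
  equation : ∀ t ∈ Ioo 0 τ, ∀ x, HasDerivAt
    (fun x => utx t x - speed k₁ k₂ k₃ (u t x) (ux t x) * m t x)
    (ut t x + damping k₂ k₃ (u t x) (ux t x) * m t x) x

namespace IsClassicalSolution

variable {k₁ k₂ k₃ τ : ℝ} {u ux m ut utx : ℝ → ℝ → ℝ}

theorem continuous_comp_u (S : IsClassicalSolution k₁ k₂ k₃ τ u ux m ut utx) {X : Type*}
    [TopologicalSpace X] {f g : X → ℝ} (hf : Continuous f) (hg : Continuous g) :
    Continuous fun x => u (f x) (g x) := S.continuous_u.comp (hf.prodMk hg)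

theorem continuous_comp_ux (S : IsClassicalSolution k₁ k₂ k₃ τ u ux m ut utx) {X : Type*}
    [TopologicalSpace X] {f g : X → ℝ} (hf : Continuous f) (hg : Continuous g) :
    Continuous fun x => ux (f x) (g x) := S.continuous_ux.comp (hf.prodMk hg)

theorem continuous_comp_m (S : IsClassicalSolution k₁ k₂ k₃ τ u ux m ut utx) {X : Type*}
    [TopologicalSpace X] {f g : X → ℝ} (hf : Continuous f) (hg : Continuous g) :
    Continuous fun x => m (f x) (g x) := S.continuous_m.comp (hf.prodMk hg)

/-- The space derivative of the speed. -/
theorem hasDerivAt_speed (S : IsClassicalSolution k₁ k₂ k₃ τ u ux m ut utx) (t x : ℝ) :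
    HasDerivAt (fun x => speed k₁ k₂ k₃ (u t x) (ux t x))
      (2 * k₁ * ux t x * m t x + 2 * k₂ * u t x * ux t x + k₃ * ux t x) x := by
  have hu := S.hasDerivAt_u t x
  have hux := S.hasDerivAt_ux t x
  have := ((((hu.pow 2).sub (hux.pow 2)).const_mul k₁).add ((hu.pow 2).const_mul k₂)).add
    (hu.const_mul k₃)
  convert! this using 1
  simp; ring

theorem exists_characteristic (S : IsClassicalSolution k₁ k₂ k₃ τ u ux m ut utx) {t₀ : ℝ}
    (ht₀ : t₀ ∈ Icc 0 τ) (x₀ : ℝ) :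
    ∃ q : ℝ → ℝ, Continuous q ∧ q t₀ = x₀ ∧
      ∀ t ∈ Ioo 0 τ, HasDerivAt q (speed k₁ k₂ k₃ (u t (q t)) (ux t (q t))) t := by
  obtain ⟨C, hC⟩ := S.bounded
  have hC0 : 0 ≤ C := (abs_nonneg _).trans (hC 0 0).1
  have hsq : ∀ {a : ℝ}, |a| ≤ C → a ^ 2 ≤ C ^ 2 := fun h => sq_le_sq' (abs_le.1 h).1 (abs_le.1 h).2
  refine exists_integralCurve (V := fun t x => speed k₁ k₂ k₃ (u t x) (ux t x))
    (L := (|k₁| * C ^ 2 + |k₂| * C ^ 2 + |k₃| * C).toNNReal)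
    (K := (2 * |k₁| * C * C + 2 * |k₂| * C * C + |k₃| * C).toNNReal) ?_ ?_ ?_ ht₀ x₀
  · intro x
    have h1 := S.continuous_comp_u continuous_id (continuous_const (y := x))
    have h2 := S.continuous_comp_ux continuous_id (continuous_const (y := x))
    simp only [id] at h1 h2
    unfold speed; fun_prop
  · intro t x
    obtain ⟨h1, h2, -⟩ := hC t x
    have h3 : |u t x ^ 2 - ux t x ^ 2| ≤ C ^ 2 := by
      rw [abs_le]; constructor <;> nlinarith [hsq h1, hsq h2, sq_nonneg (u t x), sq_nonneg (ux t x)]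
    have h4 : |u t x ^ 2| ≤ C ^ 2 := by rw [abs_of_nonneg (sq_nonneg _)]; exact hsq h1
    rw [Real.coe_toNNReal _ (by positivity)]
    refine (abs_add_three _ _ _).trans ?_
    simp only [abs_mul]
    exact add_le_add_three (mul_le_mul_of_nonneg_left h3 (abs_nonneg _))
      (mul_le_mul_of_nonneg_left h4 (abs_nonneg _)) (mul_le_mul_of_nonneg_left h1 (abs_nonneg _))
  · intro t
    refine lipschitzWith_of_nnnorm_deriv_le (fun x => (S.hasDerivAt_speed t x).differentiableAt)
      fun x => ?_
    rw [(S.hasDerivAt_speed t x).deriv, ← NNReal.coe_le_coe, coe_nnnorm, Real.norm_eq_abs,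
      Real.coe_toNNReal _ (by positivity)]
    obtain ⟨h1, h2, h3⟩ := hC t x
    refine (abs_add_three _ _ _).trans ?_
    simp only [abs_mul, abs_two]
    gcongr

/-- The derivative of `e^{-x} (u + u_x)` along a curve of velocity `v`. -/
theorem along_exp_neg (S : IsClassicalSolution k₁ k₂ k₃ τ u ux m ut utx) {t : ℝ}
    (ht : t ∈ Ioo 0 τ) {q : ℝ → ℝ} {v : ℝ} (hq : HasDerivAt q v t) :
    HasDerivAt (fun s => Real.exp (-q s) * (u s (q s) + ux s (q s)))
      (Real.exp (-q t) * (ut t (q t) + utx t (q t) - v * m t (q t))) t := by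
  have := hq.neg.exp.mul ((S.along_u t ht q v hq).add (S.along_ux t ht q v hq))
  convert! this using 1
  simp; ring

/-- The space derivative of `e^{-x} (u + u_x)`. -/
theorem hasDerivAt_exp_neg (S : IsClassicalSolution k₁ k₂ k₃ τ u ux m ut utx) (t x : ℝ) :
    HasDerivAt (fun x => Real.exp (-x) * (u t x + ux t x)) (-(Real.exp (-x) * m t x)) x := by
  have := (hasDerivAt_neg x).exp.mul ((S.hasDerivAt_u t x).add (S.hasDerivAt_ux t x))
  convert! this using 1
  simp; ring

/-- The equation in the form `(e^{-x} (u_t + u_tx - V m))_x = e^{-x} (V + h) m`. -/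
theorem hasDerivAt_exp_neg_flux (S : IsClassicalSolution k₁ k₂ k₃ τ u ux m ut utx) {t : ℝ}
    (ht : t ∈ Ioo 0 τ) (x : ℝ) :
    HasDerivAt (fun x => Real.exp (-x) * (ut t x + (utx t x
        - speed k₁ k₂ k₃ (u t x) (ux t x) * m t x)))
      (Real.exp (-x) * ((speed k₁ k₂ k₃ (u t x) (ux t x) + damping k₂ k₃ (u t x) (ux t x))
        * m t x)) x := by
  have := (hasDerivAt_neg x).exp.mul ((S.hasDerivAt_ut t x).add (S.equation t ht x))
  convert! this using 1
  simp; ring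

end IsClassicalSolution

/-- A difference quotient of a `C¹` function is an average of its derivative. -/
theorem sub_eq_mul_integral_deriv {f f' : ℝ → ℝ} (hf : ∀ x, HasDerivAt f (f' x) x)
    (hf' : Continuous f') (x ε : ℝ) :
    f (x + ε) - f x = ε * ∫ θ in (0 : ℝ)..1, f' (x + ε * θ) := by
  have h1 : ∀ θ, HasDerivAt (fun θ => f (x + ε * θ)) (ε * f' (x + ε * θ)) θ := fun θ => by
    have := (hf (x + ε * θ)).comp θ (((hasDerivAt_id θ).const_mul ε).const_add x)
    convert! this using 1
    simp; ring
  have := intervalIntegral.integral_eq_sub_of_hasDerivAt (a := 0) (b := 1) (fun θ _ => h1 θ)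
    (Continuous.intervalIntegrable (by fun_prop) _ _)
  rw [intervalIntegral.integral_const_mul] at this
  rw [this]; simp

namespace IsClassicalSolution

variable {k₁ k₂ k₃ τ : ℝ} {u ux m ut utx : ℝ → ℝ → ℝ}

/-! ### The momentum along characteristics -/

/-- Integrated form of the evolution of `e^{-q} m(t, q)` along a characteristic `q`. Although `m` is
only continuous, the average of `e^{-x} m` over `[q, q + ε]` is the difference quotient of
`e^{-x} (u + u_x)`, hence differentiable in time; the identity is the limit `ε → 0` of the
integrated derivatives. -/
theorem exp_neg_mul_momentum_eq (S : IsClassicalSolution k₁ k₂ k₃ τ u ux m ut utx) {q : ℝ → ℝ}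
    (hqc : Continuous q)
    (hq : ∀ t ∈ Ioo 0 τ, HasDerivAt q (speed k₁ k₂ k₃ (u t (q t)) (ux t (q t))) t) {t : ℝ}
    (ht : t ∈ Icc 0 τ) :
    Real.exp (-q t) * m t (q t) = Real.exp (-q 0) * m 0 (q 0) +
      ∫ s in (0 : ℝ)..t, -(Real.exp (-q s) * ((speed k₁ k₂ k₃ (u s (q s)) (ux s (q s))
        + damping k₂ k₃ (u s (q s)) (ux s (q s))
        + (2 * k₁ * ux s (q s) * m s (q s) + 2 * k₂ * u s (q s) * ux s (q s) + k₃ * ux s (q s)))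
          * m s (q s))) := by
  set Vx : ℝ → ℝ → ℝ := fun s x => 2 * k₁ * ux s x * m s x + 2 * k₂ * u s x * ux s x + k₃ * ux s x
    with hVx
  set W : ℝ → ℝ → ℝ := fun s x => Real.exp (-x) *
    ((speed k₁ k₂ k₃ (u s x) (ux s x) + damping k₂ k₃ (u s x) (ux s x)) * m s x) with hW
  have cVx : Continuous fun p : ℝ × ℝ => Vx p.1 p.2 := by
    have := S.continuous_u; have := S.continuous_ux; have := S.continuous_m
    simp only [hVx]; fun_prop
  have cW : Continuous fun p : ℝ × ℝ => W p.1 p.2 := by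
    have := S.continuous_u; have := S.continuous_ux; have := S.continuous_m
    simp only [hW, speed, damping]; fun_prop
  have cE : Continuous fun p : ℝ × ℝ => Real.exp (-p.2) * m p.1 p.2 := by
    have := S.continuous_m; fun_prop
  -- the average of `e^{-x} m` over `[q, q + ε]` and its time derivative
  set N : ℝ → ℝ → ℝ := fun ε s =>
    ∫ θ in (0 : ℝ)..1, Real.exp (-(q s + ε * θ)) * m s (q s + ε * θ) with hN
  set G : ℝ → ℝ → ℝ := fun ε s => -(∫ θ in (0 : ℝ)..1, W s (q s + ε * θ))
    - Real.exp (-(q s + ε)) * m s (q s + ε) * ∫ θ in (0 : ℝ)..1, Vx s (q s + ε * θ) with hG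
  have cpar : ∀ g : ℝ × ℝ → ℝ, Continuous g →
      Continuous fun p : ℝ × ℝ => ∫ θ in (0 : ℝ)..1, g (p.2, q p.2 + p.1 * θ) := fun g hg =>
    intervalIntegral.continuous_parametric_intervalIntegral_of_continuous'
      (f := fun (p : ℝ × ℝ) (θ : ℝ) => g (p.2, q p.2 + p.1 * θ))
      (hg.comp (by fun_prop : Continuous fun z : (ℝ × ℝ) × ℝ => (z.1.2, q z.1.2 + z.1.1 * z.2))) 0 1
  have cN : Continuous fun p : ℝ × ℝ => N p.1 p.2 := cpar _ cE
  have cG : Continuous fun p : ℝ × ℝ => G p.1 p.2 := by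
    refine ((cpar _ cW).neg).sub (Continuous.mul ?_ (cpar _ cVx))
    exact cE.comp (by fun_prop : Continuous fun p : ℝ × ℝ => (p.2, q p.2 + p.1))
  have hdiff : ∀ ε ≠ 0, ∀ s ∈ Ioo 0 τ, HasDerivAt (N ε) (G ε s) s := by
    intro ε hε s hs
    have hNe : N ε = fun s => ε⁻¹ * (Real.exp (-q s) * (u s (q s) + ux s (q s))
        - Real.exp (-(q s + ε)) * (u s (q s + ε) + ux s (q s + ε))) := by
      funext s
      have h1 := sub_eq_mul_integral_deriv (S.hasDerivAt_exp_neg s)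
        (by have := S.continuous_comp_m (continuous_const (y := s)) continuous_id
            simp only [id] at this; fun_prop) (q s) ε
      rw [intervalIntegral.integral_neg] at h1
      simp only [hN]
      field_simp
      linarith
    rw [hNe]
    have d1 := S.along_exp_neg hs (hq s hs)
    have d2 := S.along_exp_neg hs ((hq s hs).add_const ε)
    have d3 := (d1.sub d2).const_mul ε⁻¹
    refine d3.congr_deriv ?_
    have e1 := sub_eq_mul_integral_deriv (fun x => S.hasDerivAt_exp_neg_flux hs x)
      (cW.comp (by fun_prop : Continuous fun x : ℝ => (s, x))) (q s) ε
    have e2 := sub_eq_mul_integral_deriv (fun x => S.hasDerivAt_speed s x)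
      (cVx.comp (by fun_prop : Continuous fun x : ℝ => (s, x))) (q s) ε
    have e1' : ∫ θ in (0 : ℝ)..1, W s (q s + ε * θ)
        = ε⁻¹ * (ε * ∫ θ in (0 : ℝ)..1, W s (q s + ε * θ)) := by
      field_simp
    have e2' : ∫ θ in (0 : ℝ)..1, Vx s (q s + ε * θ)
        = ε⁻¹ * (ε * ∫ θ in (0 : ℝ)..1, Vx s (q s + ε * θ)) := by field_simp
    simp only [hG]
    rw [e1', e2']
    simp only [hW, hVx]
    rw [← e1, ← e2]
    ring
  have hint : ∀ ε, N ε t - N ε 0 = ∫ s in (0 : ℝ)..t, G ε s := by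
    have c1 : Continuous fun ε => N ε t - N ε 0 :=
      (cN.comp (by fun_prop : Continuous fun ε : ℝ => (ε, t))).sub
        (cN.comp (by fun_prop : Continuous fun ε : ℝ => (ε, (0 : ℝ))))
    have c2 : Continuous fun ε => ∫ s in (0 : ℝ)..t, G ε s :=
      intervalIntegral.continuous_parametric_intervalIntegral_of_continuous' (f := G) cG 0 t
    refine congrFun (Continuous.ext_on (dense_compl_singleton (0 : ℝ)) c1 c2 fun ε hε => ?_)
    refine (intervalIntegral.integral_eq_sub_of_hasDerivAt_of_le ht.1 ?_
      (fun s hs => hdiff ε hε s ⟨hs.1, hs.2.trans_le ht.2⟩) ?_).symm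
    · exact (cN.comp (by fun_prop : Continuous fun s : ℝ => (ε, s))).continuousOn
    · exact (cG.comp (by fun_prop : Continuous fun s : ℝ => (ε, s))).intervalIntegrable _ _
  have h0 := hint 0
  simp only [hN, hG, hW, hVx, zero_mul, add_zero, intervalIntegral.integral_const, sub_zero,
    one_smul] at h0
  rw [sub_eq_iff_eq_add'] at h0
  rw [h0]
  congr 2
  funext s
  ring

/-- `m` satisfies `m' = -(2 k₁ u_x m + 3 k₂ u u_x + 2 k₃ u_x) m` along characteristics. -/
theorem hasDerivAt_momentum (S : IsClassicalSolution k₁ k₂ k₃ τ u ux m ut utx) {q : ℝ → ℝ}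
    (hqc : Continuous q)
    (hq : ∀ t ∈ Ioo 0 τ, HasDerivAt q (speed k₁ k₂ k₃ (u t (q t)) (ux t (q t))) t) {t : ℝ}
    (ht : t ∈ Ioo 0 τ) :
    HasDerivAt (fun s => m s (q s)) (-(2 * k₁ * ux t (q t) * m t (q t)
      + 3 * k₂ * u t (q t) * ux t (q t) + 2 * k₃ * ux t (q t)) * m t (q t)) t := by
  set g : ℝ → ℝ := fun s => -(Real.exp (-q s) * ((speed k₁ k₂ k₃ (u s (q s)) (ux s (q s))
        + damping k₂ k₃ (u s (q s)) (ux s (q s))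
        + (2 * k₁ * ux s (q s) * m s (q s) + 2 * k₂ * u s (q s) * ux s (q s) + k₃ * ux s (q s)))
          * m s (q s))) with hg
  have cg : Continuous g := by
    have h1 := S.continuous_u
    have h2 := S.continuous_ux
    have h3 := S.continuous_m
    have : Continuous fun p : ℝ × ℝ => -(Real.exp (-p.2) * ((speed k₁ k₂ k₃ (u p.1 p.2) (ux p.1 p.2)
        + damping k₂ k₃ (u p.1 p.2) (ux p.1 p.2)
        + (2 * k₁ * ux p.1 p.2 * m p.1 p.2 + 2 * k₂ * u p.1 p.2 * ux p.1 p.2 + k₃ * ux p.1 p.2))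
          * m p.1 p.2)) := by
      simp only [speed, damping]; fun_prop
    exact this.comp (continuous_id.prodMk hqc)
  have d1 := ((hq t ht).exp.mul (((cg.integral_hasStrictDerivAt 0 t).hasDerivAt).const_add
    (Real.exp (-q 0) * m 0 (q 0))))
  have d2 : HasDerivAt (fun s => m s (q s)) _ t := d1.congr_of_eventuallyEq (by
    filter_upwards [Icc_mem_nhds ht.1 ht.2] with s hs
    simp only [Pi.mul_apply]
    rw [← S.exp_neg_mul_momentum_eq hqc hq hs, ← mul_assoc, ← Real.exp_add]
    simp)
  refine d2.congr_deriv ?_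
  simp only [hg]
  rw [← S.exp_neg_mul_momentum_eq hqc hq (Ioo_subset_Icc_self ht)]
  have e : Real.exp (q t) * Real.exp (-q t) = 1 := by rw [← Real.exp_add]; simp
  simp only [damping]
  linear_combination (-((2 * k₁ * ux t (q t) * m t (q t)
      + 3 * k₂ * u t (q t) * ux t (q t) + 2 * k₃ * ux t (q t)) * m t (q t))) * e

theorem momentum_eq_mul_exp (S : IsClassicalSolution k₁ k₂ k₃ τ u ux m ut utx) {q : ℝ → ℝ}
    (hqc : Continuous q)
    (hq : ∀ t ∈ Ioo 0 τ, HasDerivAt q (speed k₁ k₂ k₃ (u t (q t)) (ux t (q t))) t) {t : ℝ}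
    (ht : t ∈ Icc 0 τ) :
    m t (q t) = m 0 (q 0) * Real.exp (∫ s in (0 : ℝ)..t, -(2 * k₁ * ux s (q s) * m s (q s)
      + 3 * k₂ * u s (q s) * ux s (q s) + 2 * k₃ * ux s (q s))) := by
  have h1 := S.continuous_u
  have h2 := S.continuous_ux
  have h3 := S.continuous_m
  have hc : Continuous fun p : ℝ × ℝ => -(2 * k₁ * ux p.1 p.2 * m p.1 p.2
      + 3 * k₂ * u p.1 p.2 * ux p.1 p.2 + 2 * k₃ * ux p.1 p.2) := by fun_prop
  exact eq_mul_exp_of_hasDerivAt_mul (M := fun t => m t (q t))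
    (S.continuous_comp_m continuous_id hqc) (hc.comp (continuous_id.prodMk hqc))
    (fun t ht => S.hasDerivAt_momentum hqc hq ht) ht

/-- Nonnegativity of the momentum propagates: every point is reached by a characteristic. -/
theorem momentum_nonneg (S : IsClassicalSolution k₁ k₂ k₃ τ u ux m ut utx)
    (hm₀ : ∀ x, 0 ≤ m 0 x) {t : ℝ} (ht : t ∈ Icc 0 τ) (x : ℝ) : 0 ≤ m t x := by
  obtain ⟨q, hqc, rfl, hq⟩ := S.exists_characteristic ht x
  rw [S.momentum_eq_mul_exp hqc hq ht]
  exact mul_nonneg (hm₀ _) (Real.exp_nonneg _)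

/-! ### Pointwise inequalities for solutions of nonnegative momentum -/

theorem exists_bound (S : IsClassicalSolution k₁ k₂ k₃ τ u ux m ut utx) (t : ℝ) :
    ∃ C, 0 ≤ C ∧ ∀ x, |u t x| ≤ C ∧ |ux t x| ≤ C ∧ |m t x| ≤ C ∧ |ut t x| ≤ C ∧ |utx t x| ≤ C := by
  obtain ⟨C, hC⟩ := S.bounded
  obtain ⟨D, hD⟩ := S.bounded_ut t
  refine ⟨max C D, ((abs_nonneg _).trans (hC 0 0).1).trans (le_max_left _ _), fun x => ?_⟩
  obtain ⟨h1, h2, h3⟩ := hC t x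
  obtain ⟨h4, h5⟩ := hD x
  exact ⟨h1.trans (le_max_left _ _), h2.trans (le_max_left _ _), h3.trans (le_max_left _ _),
    h4.trans (le_max_right _ _), h5.trans (le_max_right _ _)⟩

theorem hasDerivAt_add (S : IsClassicalSolution k₁ k₂ k₃ τ u ux m ut utx) (t x : ℝ) :
    HasDerivAt (fun x => u t x + ux t x) (ux t x + (u t x - m t x)) x :=
  (S.hasDerivAt_u t x).add (S.hasDerivAt_ux t x)

theorem hasDerivAt_sub (S : IsClassicalSolution k₁ k₂ k₃ τ u ux m ut utx) (t x : ℝ) :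
    HasDerivAt (fun x => u t x - ux t x) (ux t x - (u t x - m t x)) x :=
  (S.hasDerivAt_u t x).sub (S.hasDerivAt_ux t x)

theorem abs_ux_le (S : IsClassicalSolution k₁ k₂ k₃ τ u ux m ut utx) {t : ℝ}
    (hm : ∀ x, 0 ≤ m t x) (x : ℝ) : |ux t x| ≤ u t x := by
  obtain ⟨C, -, hC⟩ := S.exists_bound t
  have h1 := nonneg_of_deriv_le_self (S.hasDerivAt_add t) (C := C + C)
    (fun x => (abs_add_le _ _).trans (add_le_add (hC x).1 (hC x).2.1))
    (fun x => by linarith [hm x]) x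
  have h2 := nonneg_of_neg_self_le_deriv (S.hasDerivAt_sub t) (C := C + C)
    (fun x => (abs_sub _ _).trans (add_le_add (hC x).1 (hC x).2.1))
    (fun x => by linarith [hm x]) x
  rw [abs_le]; constructor <;> linarith

theorem abs_ux_lt (S : IsClassicalSolution k₁ k₂ k₃ τ u ux m ut utx) {t : ℝ}
    (hm : ∀ x, 0 ≤ m t x) {x : ℝ} (hx : 0 < m t x) : |ux t x| < u t x := by
  obtain ⟨C, -, hC⟩ := S.exists_bound t
  have h1 := pos_of_deriv_lt_self (S.hasDerivAt_add t) (C := C + C)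
    (fun x => (abs_add_le _ _).trans (add_le_add (hC x).1 (hC x).2.1))
    (fun x => by linarith [hm x]) (x := x) (by linarith)
  have h2 := pos_of_neg_self_lt_deriv (S.hasDerivAt_sub t) (C := C + C)
    (fun x => (abs_sub _ _).trans (add_le_add (hC x).1 (hC x).2.1))
    (fun x => by linarith [hm x]) (x := x) (by linarith)
  rw [abs_lt]; constructor <;> linarith

end IsClassicalSolution

/-- A polynomial `Q(u, u_x)` such that `e^{-x} Q` grows at least as fast as
`-∫ e^{-x} (V + h) m`; this is the elementary form of the convolution estimates for the nonlocal
terms of the equation. -/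
def potential (k₁ k₂ k₃ a b : ℝ) : ℝ :=
  k₁ * (2 / 3 * a ^ 3 + a ^ 2 * b - 1 / 3 * b ^ 3)
    + k₂ * (1 / 2 * a ^ 3 + a ^ 2 * b + 1 / 2 * a * b ^ 2) + k₃ * (1 / 2 * (a + b) ^ 2)

/-- The upper bound for the derivative of `u + u_x` along characteristics. -/
def growth (k₁ k₂ k₃ a b : ℝ) : ℝ :=
  k₁ * (1 / 3 * a ^ 3 - a * b ^ 2 - 2 / 3 * b ^ 3) + k₂ / 2 * (a ^ 3 - a * b ^ 2)
    + k₃ / 2 * (a ^ 2 - b ^ 2)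

theorem abs_potential_le {k₁ k₂ k₃ a b C : ℝ} (ha : |a| ≤ C) (hb : |b| ≤ C) :
    |potential k₁ k₂ k₃ a b| ≤ |k₁| * (2 * C ^ 3) + |k₂| * (2 * C ^ 3) + |k₃| * (2 * C ^ 2) := by
  have hC : 0 ≤ C := (abs_nonneg a).trans ha
  have p : ∀ i j : ℕ, |a ^ i * b ^ j| ≤ C ^ (i + j) := fun i j => by
    rw [abs_mul, abs_pow, abs_pow, pow_add]; gcongr
  have h30 := abs_le.1 (p 3 0)
  have h21 := abs_le.1 (p 2 1)
  have h12 := abs_le.1 (p 1 2)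
  have h03 := abs_le.1 (p 0 3)
  have h20 := abs_le.1 (p 2 0)
  have h11 := abs_le.1 (p 1 1)
  have h02 := abs_le.1 (p 0 2)
  norm_num at h30 h21 h12 h03 h20 h11 h02
  refine (abs_add_three _ _ _).trans ?_
  simp only [abs_mul k₁, abs_mul k₂, abs_mul k₃]
  gcongr <;> rw [abs_le] <;> constructor <;> nlinarith

namespace IsClassicalSolution

variable {k₁ k₂ k₃ τ : ℝ} {u ux m ut utx : ℝ → ℝ → ℝ}

theorem exists_bound_flux (S : IsClassicalSolution k₁ k₂ k₃ τ u ux m ut utx) (t : ℝ) :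
    ∃ C, ∀ x, |ut t x| ≤ C ∧ |utx t x| ≤ C ∧ |speed k₁ k₂ k₃ (u t x) (ux t x) * m t x| ≤ C ∧
      |potential k₁ k₂ k₃ (u t x) (ux t x)| ≤ C ∧ |potential k₁ k₂ k₃ (u t x) (-ux t x)| ≤ C := by
  obtain ⟨C, hC0, hC⟩ := S.exists_bound t
  set A := (|k₁| * (C ^ 2 + C ^ 2) + |k₂| * C ^ 2 + |k₃| * C) * C with hA
  set B := |k₁| * (2 * C ^ 3) + |k₂| * (2 * C ^ 3) + |k₃| * (2 * C ^ 2) with hB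
  have hA0 : 0 ≤ A := by positivity
  have hB0 : 0 ≤ B := by positivity
  refine ⟨C + A + B, fun x => ?_⟩
  obtain ⟨h1, h2, h3, h4, h5⟩ := hC x
  refine ⟨by linarith, by linarith, ?_, ?_, ?_⟩
  · have : |speed k₁ k₂ k₃ (u t x) (ux t x) * m t x| ≤ A := by
      rw [abs_mul]
      refine mul_le_mul ?_ h3 (abs_nonneg _) (by positivity)
      refine (abs_add_three _ _ _).trans ?_
      simp only [abs_mul, abs_pow]
      gcongr
      refine (abs_sub _ _).trans ?_
      rw [abs_pow, abs_pow]
      gcongr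
    linarith
  · linarith [abs_potential_le (k₁ := k₁) (k₂ := k₂) (k₃ := k₃) h1 h2]
  · linarith [abs_potential_le (k₁ := k₁) (k₂ := k₂) (k₃ := k₃) (b := -ux t x) h1
      (by rwa [abs_neg])]

/-- Along characteristics `u + u_x` grows at most at the rate `growth`. -/
theorem deriv_add_le (S : IsClassicalSolution k₁ k₂ k₃ τ u ux m ut utx) (hk₁ : 0 ≤ k₁)
    (hk₂ : 0 ≤ k₂) (hk₃ : 0 ≤ k₃) {t : ℝ} (ht : t ∈ Ioo 0 τ) (hm : ∀ x, 0 ≤ m t x) (x : ℝ) :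
    (ut t x + ux t x * speed k₁ k₂ k₃ (u t x) (ux t x))
      + (utx t x + (u t x - m t x) * speed k₁ k₂ k₃ (u t x) (ux t x))
      ≤ growth k₁ k₂ k₃ (u t x) (ux t x) := by
  obtain ⟨C, hC⟩ := S.exists_bound_flux t
  have hd : ∀ x, HasDerivAt (fun x => -(ut t x + (utx t x - speed k₁ k₂ k₃ (u t x) (ux t x) * m t x)
      + potential k₁ k₂ k₃ (u t x) (ux t x)))
      (-(utx t x + (ut t x + damping k₂ k₃ (u t x) (ux t x) * m t x)
        + (k₁ * (2 * u t x ^ 2 * ux t x + 2 * u t x * ux t x ^ 2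
            + (u t x ^ 2 - ux t x ^ 2) * (u t x - m t x))
          + k₂ * (3 / 2 * u t x ^ 2 * ux t x + 2 * u t x * ux t x ^ 2 + 1 / 2 * ux t x ^ 3
            + (u t x ^ 2 + u t x * ux t x) * (u t x - m t x))
          + k₃ * ((u t x + ux t x) * (ux t x + (u t x - m t x)))))) x := by
    intro x
    have a := S.hasDerivAt_u t x
    have b := S.hasDerivAt_ux t x
    have hp := ((((a.pow 3).const_mul (2 / 3)).add ((a.pow 2).mul b)).sub
        ((b.pow 3).const_mul (1 / 3))).const_mul k₁ |>.add
      (((((a.pow 3).const_mul (1 / 2)).add ((a.pow 2).mul b)).add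
        ((a.const_mul (1 / 2)).mul (b.pow 2))).const_mul k₂) |>.add
      ((((a.add b).pow 2).const_mul (1 / 2)).const_mul k₃)
    have := (((S.hasDerivAt_ut t x).add (S.equation t ht x)).add hp).neg
    convert! this using 1
    simp; ring
  have hnn := nonneg_of_deriv_le_self hd (C := C + (C + C) + C)
    (fun x => by
      obtain ⟨h1, h2, h3, h4, -⟩ := hC x
      rw [abs_neg]
      exact (abs_add_le _ _).trans (add_le_add ((abs_add_le _ _).trans
        (add_le_add h1 ((abs_sub _ _).trans (add_le_add h2 h3)))) h4))
    (fun x => by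
      have hux := abs_le.1 (S.abs_ux_le hm x)
      have hs : 0 ≤ u t x + ux t x := by linarith
      have p1 := mul_nonneg hk₁ (pow_nonneg hs 3)
      have p2 := mul_nonneg hk₂ (pow_nonneg hs 3)
      have p3 := mul_nonneg hk₃ (pow_nonneg hs 2)
      simp only [speed, damping, potential]
      linarith) x
  simp only [speed, potential, growth] at hnn ⊢
  linarith

/-- The mirror image of `deriv_add_le`: along characteristics `u_x - u` grows at most at the
rate `growth`, evaluated at `-u_x`. -/
theorem neg_growth_le_deriv_sub (S : IsClassicalSolution k₁ k₂ k₃ τ u ux m ut utx) (hk₁ : 0 ≤ k₁)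
    (hk₂ : 0 ≤ k₂) (hk₃ : 0 ≤ k₃) {t : ℝ} (ht : t ∈ Ioo 0 τ) (hm : ∀ x, 0 ≤ m t x) (x : ℝ) :
    -growth k₁ k₂ k₃ (u t x) (-ux t x) ≤
    (ut t x + ux t x * speed k₁ k₂ k₃ (u t x) (ux t x))
      - (utx t x + (u t x - m t x) * speed k₁ k₂ k₃ (u t x) (ux t x)) := by
  obtain ⟨C, hC⟩ := S.exists_bound_flux t
  have hd : ∀ x, HasDerivAt (fun x => ut t x - (utx t x - speed k₁ k₂ k₃ (u t x) (ux t x) * m t x)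
      - potential k₁ k₂ k₃ (u t x) (-ux t x))
      (utx t x - (ut t x + damping k₂ k₃ (u t x) (ux t x) * m t x)
        - (k₁ * (2 * u t x ^ 2 * ux t x - 2 * u t x * ux t x ^ 2
            - (u t x ^ 2 - ux t x ^ 2) * (u t x - m t x))
          + k₂ * (3 / 2 * u t x ^ 2 * ux t x - 2 * u t x * ux t x ^ 2 + 1 / 2 * ux t x ^ 3
            - (u t x ^ 2 - u t x * ux t x) * (u t x - m t x))
          + k₃ * ((u t x - ux t x) * (ux t x - (u t x - m t x))))) x := by
    intro x
    have a := S.hasDerivAt_u t x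
    have b := (S.hasDerivAt_ux t x).neg
    have hp := ((((a.pow 3).const_mul (2 / 3)).add ((a.pow 2).mul b)).sub
        ((b.pow 3).const_mul (1 / 3))).const_mul k₁ |>.add
      (((((a.pow 3).const_mul (1 / 2)).add ((a.pow 2).mul b)).add
        ((a.const_mul (1 / 2)).mul (b.pow 2))).const_mul k₂) |>.add
      ((((a.add b).pow 2).const_mul (1 / 2)).const_mul k₃)
    have := ((S.hasDerivAt_ut t x).sub (S.equation t ht x)).sub hp
    convert! this using 1
    simp; ring
  have hnn := nonneg_of_neg_self_le_deriv hd (C := C + (C + C) + C)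
    (fun x => by
      obtain ⟨h1, h2, h3, -, h4⟩ := hC x
      exact (abs_sub _ _).trans (add_le_add ((abs_sub _ _).trans
        (add_le_add h1 ((abs_sub _ _).trans (add_le_add h2 h3)))) h4))
    (fun x => by
      have hux := abs_le.1 (S.abs_ux_le hm x)
      have hs : 0 ≤ u t x - ux t x := by linarith
      have p1 := mul_nonneg hk₁ (pow_nonneg hs 3)
      have p2 := mul_nonneg hk₂ (pow_nonneg hs 3)
      have p3 := mul_nonneg hk₃ (pow_nonneg hs 2)
      simp only [speed, damping, potential]
      linarith) x
  simp only [speed, potential, growth] at hnn ⊢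
  linarith

end IsClassicalSolution

/-! ### The differential inequalities on a characteristic -/

/-- The algebraic core. With `φ w = -(a + c) S(w) - 2/3 k₁ w²`, where `S` is the even part of
`growth`, `φ` is strictly concave in `w = b²` and nonnegative at `w = κ² (a + c)²` and at `w = a²`;
the shift `c` and the slope `κ` are chosen for the former to hold. -/
theorem concave_form_pos {k₁ k₂ k₃ κ c a w : ℝ} (hk₁ : 0 < k₁)
    (hκ : 4 * k₁ * κ ^ 2 = 2 * k₁ + 3 * k₂) (hc : 2 * (2 * k₁ + 3 * k₂) * c = 3 * k₃)
    (hc0 : 0 ≤ c) (ha : 0 < a) (hw : κ ^ 2 * (a + c) ^ 2 < w) (hwa : w < a ^ 2) :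
    0 < -(a + c) * (k₁ * (1 / 3 * a ^ 3 - a * w) + k₂ / 2 * (a ^ 3 - a * w)
      + k₃ / 2 * (a ^ 2 - w)) - 2 / 3 * k₁ * w ^ 2 := by
  have e2 : k₂ = (4 * k₁ * κ ^ 2 - 2 * k₁) / 3 := by linarith
  have e3 : k₃ = 8 / 3 * k₁ * κ ^ 2 * c := by
    rw [← hκ] at hc; linarith
  subst e2 e3
  set l := κ ^ 2 * (a + c) ^ 2 with hl
  have hd : 0 < a ^ 2 - l := by linarith
  have p1 : 0 ≤ k₁ / 3 * (a + c) * (2 * κ ^ 2 * c ^ 2 * a + 2 * (κ ^ 2) ^ 2 * (a + c) ^ 2 * c) := by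
    positivity
  have p2 : 0 ≤ 2 / 3 * k₁ * a ^ 3 * c := by positivity
  have p3 : 0 < 2 / 3 * k₁ * (w - l) * (a ^ 2 - w) * (a ^ 2 - l) := by
    have h1 : 0 < w - l := by linarith
    have h2 : 0 < a ^ 2 - w := by linarith
    positivity
  refine pos_of_mul_pos_right (a := a ^ 2 - l) ?_ hd.le
  have q1 := mul_nonneg (sub_pos.2 hwa).le p1
  have q2 := mul_nonneg (sub_pos.2 hw).le p2
  have := add_pos_of_nonneg_of_pos (add_nonneg q1 q2) p3
  refine this.trans_le (le_of_eq ?_)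
  simp only [hl]
  ring

/-- Along a characteristic, a slope `u_x` that is steep with respect to `u` stays so, hence
decreases, and drives the momentum to infinity in finite time. -/
theorem lt_of_steep {k₁ k₂ k₃ κ c τ : ℝ} {X Y M X' Y' : ℝ → ℝ} (hk₁ : 0 < k₁) (hk₂ : 0 ≤ k₂)
    (hk₃ : 0 ≤ k₃) (hκ0 : 0 ≤ κ) (hκ : 4 * k₁ * κ ^ 2 = 2 * k₁ + 3 * k₂) (hc0 : 0 ≤ c)
    (hc : 2 * (2 * k₁ + 3 * k₂) * c = 3 * k₃) (hτ : 0 < τ)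
    (cX : Continuous X) (cY : Continuous Y) (cM : Continuous M)
    (dX : ∀ t ∈ Ioo 0 τ, HasDerivAt X (X' t) t) (dY : ∀ t ∈ Ioo 0 τ, HasDerivAt Y (Y' t) t)
    (dM : ∀ t ∈ Ioo 0 τ, HasDerivAt M
      (-(2 * k₁ * Y t * M t + 3 * k₂ * X t * Y t + 2 * k₃ * Y t) * M t) t)
    (hadd : ∀ t ∈ Ioo 0 τ, X' t + Y' t ≤ growth k₁ k₂ k₃ (X t) (Y t))
    (hsub : ∀ t ∈ Ioo 0 τ, -growth k₁ k₂ k₃ (X t) (-Y t) ≤ X' t - Y' t)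
    (hYX : ∀ t ∈ Icc 0 τ, |Y t| < X t) (hM : ∀ t ∈ Icc 0 τ, 0 < M t)
    (hsteep : Y 0 < -κ * (X 0 + c)) :
    τ < -(1 / (2 * k₁ * M 0 * Y 0)) := by
  have hX : ∀ t ∈ Icc 0 τ, 0 < X t := fun t ht => (abs_nonneg _).trans_lt (hYX t ht)
  have h00 : (0 : ℝ) ∈ Icc 0 τ := ⟨le_rfl, hτ.le⟩
  have hv0 : 0 < X 0 + c := by linarith [hX 0 h00]
  obtain ⟨K, hK1, hK2⟩ : ∃ K, κ < K ∧ K < -Y 0 / (X 0 + c) := by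
    refine exists_between ((lt_div_iff₀ hv0).2 ?_)
    linarith
  have hK0 : 0 < K := hκ0.trans_lt hK1
  rw [lt_div_iff₀ hv0] at hK2
  -- `S` is the even part of `growth`
  set S : ℝ → ℝ := fun t => k₁ * (1 / 3 * X t ^ 3 - X t * Y t ^ 2)
    + k₂ / 2 * (X t ^ 3 - X t * Y t ^ 2) + k₃ / 2 * (X t ^ 2 - Y t ^ 2) with hS
  have key : ∀ t ∈ Icc 0 τ, K * (X t + c) ≤ -Y t →
      0 < -(X t + c) * S t - 2 / 3 * k₁ * (Y t ^ 2) ^ 2 := by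
    intro t ht hle
    have hv : 0 < X t + c := by linarith [hX t ht]
    refine concave_form_pos hk₁ hκ hc hc0 (hX t ht) ?_ ?_
    · have h1 : κ * (X t + c) < -Y t := (mul_lt_mul_of_pos_right hK1 hv).trans_le hle
      rw [← mul_pow, ← neg_sq (Y t)]
      exact pow_lt_pow_left₀ h1 (by positivity) two_ne_zero
    · exact sq_lt_sq' (by linarith [(abs_lt.1 (hYX t ht)).1]) (abs_lt.1 (hYX t ht)).2
  have steep : ∀ t ∈ Icc 0 τ, K * (X t + c) + Y t ≤ 0 := by
    have cf : Continuous fun t => K * (X t + c) + Y t := by fun_prop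
    obtain ⟨δ, hδ0, hδ⟩ : ∃ δ > 0, ∀ t ∈ Icc 0 δ, K * (X t + c) + Y t ≤ 0 := by
      have hn : ∀ᶠ t in 𝓝 (0 : ℝ), K * (X t + c) + Y t < 0 :=
        (cf.tendsto 0).eventually_lt_const (by linarith)
      obtain ⟨δ, hδ, h⟩ := Metric.eventually_nhds_iff_ball.1 hn
      refine ⟨δ / 2, by positivity, fun t ht => (h t ?_).le⟩
      rw [Metric.mem_ball, Real.dist_eq, sub_zero, abs_of_nonneg ht.1]
      linarith [ht.2]
    intro t ht
    rcases le_total t δ with h | h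
    · exact hδ t ⟨ht.1, h⟩
    refine image_le_of_deriv_right_lt_deriv_boundary' (f := fun t => K * (X t + c) + Y t)
      (f' := fun t => K * X' t + Y' t) (B := fun _ => 0) (B' := fun _ => 0) (a := δ) (b := τ)
      cf.continuousOn (fun s hs => ?_) (hδ δ ⟨hδ0.le, le_rfl⟩) continuousOn_const
      (fun s _ => hasDerivWithinAt_const _ _ _) (fun s hs hs0 => ?_) ⟨h, ht.2⟩
    · have hs' : s ∈ Ioo 0 τ := ⟨hδ0.trans_le hs.1, hs.2⟩
      exact ((((dX s hs').add_const c).const_mul K).add (dY s hs')).hasDerivWithinAt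
    · have hs' : s ∈ Ioo 0 τ := ⟨hδ0.trans_le hs.1, hs.2⟩
      have hsI := Ioo_subset_Icc_self hs'
      replace hs0 : K * (X s + c) + Y s = 0 := hs0
      have hv : 0 < X s + c := by linarith [hX s hsI]
      have hp := key s hsI (by linarith)
      have hK' : K < 1 := by
        by_contra! h1
        have := abs_lt.1 (hYX s hsI)
        nlinarith
      have a1 := mul_le_mul_of_nonneg_left (hadd s hs') (by linarith : 0 ≤ (1 + K) / 2)
      have a2 := mul_le_mul_of_nonneg_left (hsub s hs') (by linarith : 0 ≤ (1 - K) / 2)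
      have hY : Y s = -(K * (X s + c)) := by linarith
      -- `(X + c)` times the bound for the derivative is minus the form in `key`
      have a3 : 0 < (X s + c) * -((1 + K) / 2 * growth k₁ k₂ k₃ (X s) (Y s)
          + (1 - K) / 2 * growth k₁ k₂ k₃ (X s) (-Y s)) := by
        refine hp.trans_le (le_of_eq ?_)
        simp only [hS, growth]
        rw [hY]
        ring
      have a4 := (mul_pos_iff_of_pos_left hv).1 a3
      linarith
  have hY' : ∀ t ∈ Ioo 0 τ, Y' t ≤ 0 := by
    intro t ht
    have htI := Ioo_subset_Icc_self ht
    have hv : 0 < X t + c := by linarith [hX t htI]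
    have hp := key t htI (by linarith [steep t htI])
    have h1 : 0 < (X t + c) * -S t := by
      have : 0 ≤ 2 / 3 * k₁ * (Y t ^ 2) ^ 2 := by positivity
      linarith
    have h2 := (mul_pos_iff_of_pos_left hv).1 h1
    have h3 := hadd t ht
    have h4 := hsub t ht
    simp only [growth, hS] at *
    linarith
  have hYle : ∀ t ∈ Icc 0 τ, Y t ≤ Y 0 := by
    have hanti : AntitoneOn Y (Icc 0 τ) := by
      refine antitoneOn_of_deriv_nonpos (convex_Icc 0 τ) cY.continuousOn ?_ ?_
      · rw [interior_Icc]
        exact fun t ht => (dY t ht).differentiableAt.differentiableWithinAt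
      · rw [interior_Icc]
        exact fun t ht => by rw [(dY t ht).deriv]; exact hY' t ht
    exact fun t ht => hanti h00 ht ht.1
  have hY0 : Y 0 < 0 := by
    have : 0 ≤ κ * (X 0 + c) := by positivity
    linarith
  have hfin : AntitoneOn (fun t => (M t)⁻¹ - 2 * k₁ * Y 0 * t) (Icc 0 τ) := by
    have hd : ∀ t ∈ Ioo 0 τ, HasDerivAt (fun t => (M t)⁻¹ - 2 * k₁ * Y 0 * t) _ t := fun t ht =>
      ((dM t ht).inv (hM t (Ioo_subset_Icc_self ht)).ne').sub
        ((hasDerivAt_id t).const_mul (2 * k₁ * Y 0))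
    refine antitoneOn_of_deriv_nonpos (convex_Icc 0 τ) ?_ ?_ ?_
    · exact (cM.continuousOn.inv₀ fun t ht => (hM t ht).ne').sub (by fun_prop)
    · rw [interior_Icc]
      exact fun t ht => (hd t ht).differentiableAt.differentiableWithinAt
    · rw [interior_Icc]
      intro t ht
      rw [(hd t ht).deriv]
      have htI := Ioo_subset_Icc_self ht
      have hMt := hM t htI
      have hYt := hYle t htI
      have e : -(-(2 * k₁ * Y t * M t + 3 * k₂ * X t * Y t + 2 * k₃ * Y t) * M t) / M t ^ 2
          = 2 * k₁ * Y t + (3 * k₂ * X t + 2 * k₃) * Y t / M t := by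
        field_simp
        ring
      rw [e]
      have h1 : (3 * k₂ * X t + 2 * k₃) * Y t / M t ≤ 0 := by
        have hXt := hX t htI
        refine div_nonpos_of_nonpos_of_nonneg
          (mul_nonpos_of_nonneg_of_nonpos (by positivity) (by linarith)) hMt.le
      have h2 : 2 * k₁ * Y t ≤ 2 * k₁ * Y 0 := by gcongr
      linarith
  have hττ : τ ∈ Icc 0 τ := ⟨hτ.le, le_rfl⟩
  have h1 := hfin h00 hττ hτ.le
  simp only [mul_zero, sub_zero] at h1
  have h2 : 0 < (M τ)⁻¹ := inv_pos.2 (hM τ hττ)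
  have hM0 := hM 0 h00
  have h3 : -(2 * k₁ * Y 0) * τ < (M 0)⁻¹ := by linarith
  have h4 : 0 < -(2 * k₁ * Y 0) := by nlinarith
  have h5 : -(1 / (2 * k₁ * M 0 * Y 0)) = (M 0)⁻¹ / (-(2 * k₁ * Y 0)) := by
    have := hY0.ne
    field_simp
  rw [h5, lt_div_iff₀ h4]
  linarith

/-- The lifespan bound for solutions in classical form. -/
theorem IsClassicalSolution.lt_of_steep {k₁ k₂ k₃ κ c τ : ℝ} {u ux m ut utx : ℝ → ℝ → ℝ}
    (S : IsClassicalSolution k₁ k₂ k₃ τ u ux m ut utx) (hk₁ : 0 < k₁) (hk₂ : 0 ≤ k₂)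
    (hk₃ : 0 ≤ k₃) (hκ0 : 0 ≤ κ) (hκ : 4 * k₁ * κ ^ 2 = 2 * k₁ + 3 * k₂) (hc0 : 0 ≤ c)
    (hc : 2 * (2 * k₁ + 3 * k₂) * c = 3 * k₃) (hτ : 0 < τ) (hm₀ : ∀ x, 0 ≤ m 0 x) {x₀ : ℝ}
    (hx₀ : 0 < m 0 x₀) (hsteep : ux 0 x₀ < -κ * (u 0 x₀ + c)) :
    τ < -(1 / (2 * k₁ * m 0 x₀ * ux 0 x₀)) := by
  obtain ⟨q, hqc, hq0, hq⟩ := S.exists_characteristic (t₀ := 0) ⟨le_rfl, hτ.le⟩ x₀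
  have hmt : ∀ t ∈ Icc 0 τ, ∀ x, 0 ≤ m t x := fun t ht => S.momentum_nonneg hm₀ ht
  have hmpos : ∀ t ∈ Icc 0 τ, 0 < m t (q t) := fun t ht => by
    rw [S.momentum_eq_mul_exp hqc hq ht, hq0]
    exact mul_pos hx₀ (Real.exp_pos _)
  have := MCHNovikovCH.lt_of_steep (X := fun t => u t (q t)) (Y := fun t => ux t (q t))
    (M := fun t => m t (q t)) hk₁ hk₂ hk₃ hκ0 hκ hc0 hc hτ
    (S.continuous_comp_u continuous_id hqc) (S.continuous_comp_ux continuous_id hqc)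
    (S.continuous_comp_m continuous_id hqc)
    (fun t ht => S.along_u t ht q _ (hq t ht)) (fun t ht => S.along_ux t ht q _ (hq t ht))
    (fun t ht => S.hasDerivAt_momentum hqc hq ht)
    (fun t ht => S.deriv_add_le hk₁.le hk₂ hk₃ ht (hmt t (Ioo_subset_Icc_self ht)) (q t))
    (fun t ht => S.neg_growth_le_deriv_sub hk₁.le hk₂ hk₃ ht (hmt t (Ioo_subset_Icc_self ht)) (q t))
    (fun t ht => S.abs_ux_lt (hmt t ht) (hmpos t ht)) hmpos (by simpa only [hq0] using hsteep)
  simpa only [hq0] using this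

/-! ### Weak derivatives on the line -/

/-- A smooth compactly supported function of integral zero has a smooth compactly supported
primitive. -/
theorem exists_primitive_hasCompactSupport {ψ : ℝ → ℝ} (hψ : ContDiff ℝ ∞ ψ)
    (hc : HasCompactSupport ψ) (h0 : ∫ x, ψ x = 0) :
    ∃ Φ : ℝ → ℝ, ContDiff ℝ ∞ Φ ∧ HasCompactSupport Φ ∧ deriv Φ = ψ := by
  have hint : Integrable ψ := hψ.continuous.integrable_of_hasCompactSupport hc
  obtain ⟨R, hR⟩ : ∃ R, ∀ x, R < |x| → ψ x = 0 := by
    obtain ⟨R, hR⟩ := hc.isCompact.isBounded.subset_closedBall (0 : ℝ)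
    refine ⟨R, fun x hx => image_eq_zero_of_notMem_tsupport fun hmem => ?_⟩
    have := hR hmem
    rw [Metric.mem_closedBall, Real.dist_eq, sub_zero] at this
    linarith
  set Φ : ℝ → ℝ := fun x => ∫ y in Iic x, ψ y with hΦ
  have hΦ0 : ∀ x, Φ x = (∫ y in Iic 0, ψ y) + ∫ y in (0 : ℝ)..x, ψ y := fun x => by
    rw [← intervalIntegral.integral_Iic_sub_Iic hint.integrableOn hint.integrableOn]; ring
  have hd : ∀ x, HasDerivAt Φ (ψ x) x := fun x => by
    rw [funext hΦ0]
    exact (hψ.continuous.integral_hasStrictDerivAt 0 x).hasDerivAt.const_add _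
  have hderiv : deriv Φ = ψ := funext fun x => (hd x).deriv
  refine ⟨Φ, ?_, ?_, hderiv⟩
  · rw [contDiff_infty_iff_deriv, hderiv]
    exact ⟨fun x => (hd x).differentiableAt, hψ⟩
  · refine HasCompactSupport.intro (isCompact_closedBall (0 : ℝ) R) fun x hx => ?_
    rw [Metric.mem_closedBall, Real.dist_eq, sub_zero, not_le] at hx
    rcases lt_abs.1 hx with h | h
    · rw [hΦ]
      simp only
      rw [setIntegral_eq_integral_of_forall_compl_eq_zero, h0]
      intro y hy
      rw [mem_Iic, not_le] at hy
      exact hR y ((h.trans hy).trans_le (le_abs_self y))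
    · refine setIntegral_eq_zero_of_forall_eq_zero fun y hy => hR y ?_
      exact (h.trans_le (neg_le_neg hy)).trans_le (neg_le_abs y)

/-- The lemma of du Bois-Reymond. -/
theorem eq_of_forall_integral_mul_deriv_eq_zero {N : ℝ → ℝ} (hN : Continuous N)
    (h : ∀ φ : ℝ → ℝ, ContDiff ℝ ∞ φ → HasCompactSupport φ → ∫ x, N x * deriv φ x = 0) :
    ∃ c, ∀ x, N x = c := by
  let b : ContDiffBump (0 : ℝ) := ⟨1, 2, one_pos, one_lt_two⟩
  set η : ℝ → ℝ := b.normed volume with hη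
  have hηs : ContDiff ℝ ∞ η := b.contDiff_normed
  have hηc : HasCompactSupport η := b.hasCompactSupport_normed
  have hη1 : ∫ x, η x = 1 := b.integral_normed
  have hηi : Integrable η := hηs.continuous.integrable_of_hasCompactSupport hηc
  have hNi : ∀ g : ℝ → ℝ, Continuous g → HasCompactSupport g → Integrable fun x => N x * g x :=
    fun g hg hgc => (hN.mul hg).integrable_of_hasCompactSupport hgc.mul_left
  refine ⟨∫ x, N x * η x, fun x => ?_⟩
  refine congrFun ((Continuous.ae_eq_iff_eq volume hN continuous_const).1 ?_) x
  refine ae_eq_of_integral_contDiff_smul_eq hN.locallyIntegrable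
    continuous_const.locallyIntegrable fun g hg hgc => ?_
  have hgi : Integrable g := hg.continuous.integrable_of_hasCompactSupport hgc
  obtain ⟨Φ, hΦs, hΦc, hΦd⟩ := exists_primitive_hasCompactSupport
    (ψ := fun x => g x - (∫ y, g y) * η x) (by fun_prop)
    (hgc.sub (hηc.mul_left (f := fun _ => ∫ y, g y)))
    (by rw [integral_sub hgi (hηi.const_mul _), integral_const_mul, hη1]; ring)
  have h0 := h Φ hΦs hΦc
  have e : ∀ x, N x * (g x - (∫ y, g y) * η x) = N x * g x - (∫ y, g y) * (N x * η x) :=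
    fun x => by ring
  rw [hΦd] at h0
  simp only [e] at h0
  rw [integral_sub (hNi g hg.continuous hgc) ((hNi η hηs.continuous hηc).const_mul _),
    integral_const_mul, sub_eq_zero] at h0
  simp only [smul_eq_mul]
  rw [integral_mul_const, ← h0]
  congr 1; ext x; ring

theorem integral_mul_deriv_eq_neg_of_hasDerivAt {P g φ : ℝ → ℝ} (hP : ∀ x, HasDerivAt P (g x) x)
    (hg : Continuous g) (hφ : ContDiff ℝ 1 φ) (hφc : HasCompactSupport φ) :
    ∫ x, P x * deriv φ x = -∫ x, g x * φ x := by
  have hPc : Continuous P := continuous_iff_continuousAt.2 fun x => (hP x).continuousAt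
  have hφ' : Continuous (deriv φ) := hφ.continuous_deriv le_rfl
  exact integral_mul_deriv_eq_deriv_mul_of_integrable (fun x _ => hP x)
    (fun x _ => (hφ.differentiable one_ne_zero x).hasDerivAt)
    ((hPc.mul hφ').integrable_of_hasCompactSupport hφc.deriv.mul_left)
    ((hg.mul hφ.continuous).integrable_of_hasCompactSupport hφc.mul_left)
    ((hPc.mul hφ.continuous).integrable_of_hasCompactSupport hφc.mul_left)

/-- A continuous function whose distributional derivative is continuous is differentiable. -/
theorem hasDerivAt_of_forall_integral_mul_deriv {N g : ℝ → ℝ} (hN : Continuous N)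
    (hg : Continuous g) (h : ∀ φ : ℝ → ℝ, ContDiff ℝ ∞ φ → HasCompactSupport φ →
      ∫ x, N x * deriv φ x = -∫ x, g x * φ x) (x : ℝ) : HasDerivAt N (g x) x := by
  set P : ℝ → ℝ := fun x => ∫ y in (0 : ℝ)..x, g y with hPdef
  have hP : ∀ x, HasDerivAt P (g x) x := fun x => (hg.integral_hasStrictDerivAt 0 x).hasDerivAt
  have hPc : Continuous P := continuous_iff_continuousAt.2 fun x => (hP x).continuousAt
  obtain ⟨c, hc⟩ := eq_of_forall_integral_mul_deriv_eq_zero (hN.sub hPc) fun φ hφ hφc => by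
    have hφ' : Continuous (deriv φ) := hφ.continuous_deriv (by norm_num)
    have e : ∀ x, (N - P) x * deriv φ x = N x * deriv φ x - P x * deriv φ x :=
      fun x => by simp only [Pi.sub_apply]; ring
    simp only [e]
    have i1 : Integrable fun x => N x * deriv φ x :=
      (hN.mul hφ').integrable_of_hasCompactSupport hφc.deriv.mul_left
    have i2 : Integrable fun x => P x * deriv φ x :=
      (hPc.mul hφ').integrable_of_hasCompactSupport hφc.deriv.mul_left
    rw [integral_sub i1 i2, h φ hφ hφc,
      integral_mul_deriv_eq_neg_of_hasDerivAt hP hg (hφ.of_le (by norm_num)) hφc, sub_self]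
  have : N = fun x => P x + c := funext fun x => by
    have := hc x
    simp only [Pi.sub_apply] at this
    linarith
  rw [this]
  exact (hP x).add_const c

/-! ### Curves in `L²` evaluated by uniformly bounded functionals -/

section Evaluation

variable {H : Type*} [NormedAddCommGroup H] [NormedSpace ℝ H] {ev : ℝ → H →L[ℝ] ℝ} {C : ℝ}

theorem continuous_eval_of_norm_le (hC : ∀ x, ‖ev x‖ ≤ C) (hc : ∀ F, Continuous fun x => ev x F) :
    Continuous fun p : H × ℝ => ev p.2 p.1 := by
  refine continuous_iff_continuousAt.2 fun p₀ => ?_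
  have h1 : Tendsto (fun p : H × ℝ => ev p.2 (p.1 - p₀.1)) (𝓝 p₀) (𝓝 0) := by
    refine squeeze_zero_norm (a := fun p : H × ℝ => C * ‖p.1 - p₀.1‖)
      (fun p => (ev p.2).le_of_opNorm_le (hC _) _) ?_
    have : Continuous fun p : H × ℝ => C * ‖p.1 - p₀.1‖ := by fun_prop
    simpa using this.tendsto p₀
  have h2 : Tendsto (fun p : H × ℝ => ev p.2 p₀.1) (𝓝 p₀) (𝓝 (ev p₀.2 p₀.1)) :=
    ((hc p₀.1).comp continuous_snd).tendsto p₀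
  have := h1.add h2
  rw [zero_add] at this
  exact this.congr fun p => by simp

/-- The chain rule for `t ↦ ev (q t) (U t)`; differentiability of `x ↦ ev x F` is only needed at
`F = U t`. -/
theorem hasDerivAt_eval_comp (hC : ∀ x, ‖ev x‖ ≤ C) (hc : ∀ F, Continuous fun x => ev x F)
    {U : ℝ → H} {U' : H} {q : ℝ → ℝ} {v d t : ℝ} (hU : HasDerivAt U U' t)
    (hd : HasDerivAt (fun x => ev x (U t)) d (q t)) (hq : HasDerivAt q v t) :
    HasDerivAt (fun s => ev (q s) (U s)) (ev (q t) U' + d * v) t := by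
  have h2 : HasDerivAt (fun s => ev (q s) (U t)) (d * v) t := hd.comp t hq
  have h1 : HasDerivAt (fun s => ev (q s) (U s - U t)) (ev (q t) U') t := by
    rw [hasDerivAt_iff_tendsto_slope]
    have hs : Tendsto (fun s => ((slope U t s), q s)) (𝓝[≠] t) (𝓝 (U', q t)) :=
      (hasDerivAt_iff_tendsto_slope.1 hU).prodMk_nhds
        (hq.continuousAt.tendsto.mono_left nhdsWithin_le_nhds)
    refine (((continuous_eval_of_norm_le hC hc).tendsto (U', q t)).comp hs).congr fun s => ?_
    simp [slope]
  have := h1.add h2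
  refine this.congr_of_eventuallyEq (Eventually.of_forall fun s => ?_)
  simp

end Evaluation

/-! ### Strong solutions are classical solutions -/

theorem HasBesselPotential.eq_besselEvalCLM {σ : ℝ} {f : ℝ → ℝ}
    {F : Lp ℂ 2 (volume : Measure ℝ)} (hf : HasBesselPotential σ f F)
    (h₀ : ((0 : ℕ) : ℝ) + 1 / 2 < σ) (x : ℝ) : f x = besselEvalCLM h₀ x F := by
  rw [besselEvalCLM_apply, ← hf.eq_besselEval (by simpa using h₀), Complex.ofReal_re]

theorem HasBesselPotential.hasDerivAt {σ : ℝ} {f : ℝ → ℝ} {F : Lp ℂ 2 (volume : Measure ℝ)}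
    (hf : HasBesselPotential σ f F) (h₀ : ((0 : ℕ) : ℝ) + 1 / 2 < σ)
    (h₁ : ((0 + 1 : ℕ) : ℝ) + 1 / 2 < σ) (x : ℝ) : HasDerivAt f (besselEvalCLM h₁ x F) x :=
  (hasDerivAt_besselEvalCLM h₀ h₁ F x).congr_of_eventuallyEq
    (Eventually.of_forall fun y => hf.eq_besselEvalCLM h₀ y)

/-- The equation in the sense of distributions, for functions of class `C²` with `u_t` of class
`C¹`, is the equation integrated once in space. -/
theorem SatisfiesEquationAt.hasDerivAt {k₁ k₂ k₃ t : ℝ} {u : ℝ → ℝ → ℝ}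
    (h : SatisfiesEquationAt k₁ k₂ k₃ u t) {ux m ut utx : ℝ → ℝ}
    (hu : ∀ x, HasDerivAt (u t) (ux x) x) (hux : ∀ x, HasDerivAt ux (u t x - m x) x)
    (hm : Continuous m) (hut : ∀ x, HasDerivAt (fun s => u s x) (ut x) t)
    (hutx : ∀ x, HasDerivAt ut (utx x) x) (hutxc : Continuous utx) (x : ℝ) :
    HasDerivAt (fun x => utx x - speed k₁ k₂ k₃ (u t x) (ux x) * m x)
      (ut x + damping k₂ k₃ (u t x) (ux x) * m x) x := by
  have cu : Continuous (u t) := continuous_iff_continuousAt.2 fun x => (hu x).continuousAt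
  have cux : Continuous ux := continuous_iff_continuousAt.2 fun x => (hux x).continuousAt
  have cut : Continuous ut := continuous_iff_continuousAt.2 fun x => (hutx x).continuousAt
  have e1 : deriv (u t) = ux := funext fun x => (hu x).deriv
  have e2 : momentum (u t) = m := funext fun x => by
    rw [momentum, e1, (hux x).deriv]; ring
  have e3 : ∀ x, deriv (fun s => u s x) t = ut x := fun x => (hut x).deriv
  have cN : Continuous fun x => utx x - speed k₁ k₂ k₃ (u t x) (ux x) * m x := by
    unfold speed; fun_prop
  have cg : Continuous fun x => ut x + damping k₂ k₃ (u t x) (ux x) * m x := by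
    unfold damping; fun_prop
  refine hasDerivAt_of_forall_integral_mul_deriv cN cg (fun φ hφ hφc => ?_) x
  have hE := h φ hφ hφc
  simp only [e1, e2, e3] at hE
  have hφ1 : ContDiff ℝ ∞ (deriv φ) := (contDiff_infty_iff_deriv.1 hφ).2
  have cφ := hφ.continuous
  have cφ1 := hφ1.continuous
  have cφ2 : Continuous (deriv (deriv φ)) := (contDiff_infty_iff_deriv.1 hφ1).2.continuous
  have s1 := hφc.deriv
  have i0 : ∀ g : ℝ → ℝ, Continuous g → Integrable fun x => g x * φ x := fun g hg =>
    (hg.mul cφ).integrable_of_hasCompactSupport hφc.mul_left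
  have i1 : ∀ g : ℝ → ℝ, Continuous g → Integrable fun x => g x * deriv φ x := fun g hg =>
    (hg.mul cφ1).integrable_of_hasCompactSupport s1.mul_left
  have i2 : ∀ g : ℝ → ℝ, Continuous g → Integrable fun x => g x * deriv (deriv φ) x := fun g hg =>
    (hg.mul cφ2).integrable_of_hasCompactSupport s1.deriv.mul_left
  have p := integral_mul_deriv_eq_neg_of_hasDerivAt hutx hutxc (hφ1.of_le (by norm_num)) s1
  have f1 : ∫ x, ut x * (φ x - deriv (deriv φ) x)
      = (∫ x, ut x * φ x) + ∫ x, utx x * deriv φ x := by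
    simp only [mul_sub]
    rw [integral_sub (i0 _ cut) (i2 _ cut), p]; ring
  have f2 : ∫ x, (u t x * ux x * m x * φ x - u t x ^ 2 * m x * deriv φ x)
      = (∫ x, u t x * ux x * m x * φ x) - ∫ x, u t x ^ 2 * m x * deriv φ x :=
    integral_sub (i0 (fun x => u t x * ux x * m x) (by fun_prop))
      (i1 (fun x => u t x ^ 2 * m x) (by fun_prop))
  have f3 : ∫ x, (ux x * m x * φ x - u t x * m x * deriv φ x)
      = (∫ x, ux x * m x * φ x) - ∫ x, u t x * m x * deriv φ x :=
    integral_sub (i0 (fun x => ux x * m x) (by fun_prop)) (i1 (fun x => u t x * m x) (by fun_prop))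
  have f4 : ∫ x, (utx x - speed k₁ k₂ k₃ (u t x) (ux x) * m x) * deriv φ x
      = (∫ x, utx x * deriv φ x) - (k₁ * (∫ x, (u t x ^ 2 - ux x ^ 2) * m x * deriv φ x)
        + k₂ * (∫ x, u t x ^ 2 * m x * deriv φ x) + k₃ * ∫ x, u t x * m x * deriv φ x) := by
    have j1 := (i1 (fun x => (u t x ^ 2 - ux x ^ 2) * m x) (by fun_prop)).const_mul k₁
    have j2 := (i1 (fun x => u t x ^ 2 * m x) (by fun_prop)).const_mul k₂
    have j3 := (i1 (fun x => u t x * m x) (by fun_prop)).const_mul k₃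
    have j12 : Integrable fun x => k₁ * ((u t x ^ 2 - ux x ^ 2) * m x * deriv φ x)
        + k₂ * (u t x ^ 2 * m x * deriv φ x) := j1.add j2
    have j123 : Integrable fun x => k₁ * ((u t x ^ 2 - ux x ^ 2) * m x * deriv φ x)
        + k₂ * (u t x ^ 2 * m x * deriv φ x) + k₃ * (u t x * m x * deriv φ x) := j12.add j3
    rw [← integral_const_mul, ← integral_const_mul, ← integral_const_mul,
      ← integral_add j1 j2, ← integral_add j12 j3, ← integral_sub (i1 _ hutxc) j123]
    congr 1; ext x; simp only [speed]; ring
  have f5 : ∫ x, (ut x + damping k₂ k₃ (u t x) (ux x) * m x) * φ x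
      = (∫ x, ut x * φ x) + (k₂ * (∫ x, u t x * ux x * m x * φ x)
        + k₃ * ∫ x, ux x * m x * φ x) := by
    have j2 := (i0 (fun x => u t x * ux x * m x) (by fun_prop)).const_mul k₂
    have j3 := (i0 (fun x => ux x * m x) (by fun_prop)).const_mul k₃
    have j23 : Integrable fun x => k₂ * (u t x * ux x * m x * φ x) + k₃ * (ux x * m x * φ x) :=
      j2.add j3
    rw [← integral_const_mul, ← integral_const_mul, ← integral_add j2 j3,
      ← integral_add (i0 _ cut) j23]
    congr 1; ext x; simp only [damping]; ring
  rw [f1, f2, f3] at hE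
  rw [f4, f5]
  linarith

/-- A bounded family of continuous linear functionals `ev x` with the property that every
`x ↦ ev x F` is continuous. -/
structure IsEvaluation {H : Type*} [NormedAddCommGroup H] [NormedSpace ℝ H]
    (ev : ℝ → H →L[ℝ] ℝ) : Prop where
  bounded : ∃ C, ∀ x, ‖ev x‖ ≤ C
  continuous : ∀ F, Continuous fun x => ev x F

theorem isEvaluation_besselEvalCLM {σ : ℝ} {j : ℕ} (h : j + 1 / 2 < σ) :
    IsEvaluation (besselEvalCLM h) :=
  ⟨⟨_, norm_besselEvalCLM_le h⟩, continuous_besselEvalCLM h⟩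

section

variable {H : Type*} [NormedAddCommGroup H] [NormedSpace ℝ H]

theorem IsEvaluation.exists_bound {ev : ℝ → H →L[ℝ] ℝ} (h : IsEvaluation ev) (B : ℝ) :
    ∃ D, 0 ≤ D ∧ ∀ F x, ‖F‖ ≤ B → |ev x F| ≤ D := by
  obtain ⟨C, hC⟩ := h.bounded
  refine ⟨|C| * |B|, by positivity, fun F x hF => ?_⟩
  exact ((ev x).le_of_opNorm_le ((hC x).trans (le_abs_self C)) F).trans
    (mul_le_mul_of_nonneg_left (hF.trans (le_abs_self B)) (abs_nonneg C))

/-- A solution which is represented, on `[0, τ]`, by a continuous curve `U` with two space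
derivatives, and by a curve `U₁`, differentiable in time, with one space derivative, is a classical
solution on `[0, τ]`. Times outside `[0, τ]` are projected onto `[0, τ]`. -/
theorem isClassicalSolution_of_isEvaluation {k₁ k₂ k₃ τ : ℝ} {u : ℝ → ℝ → ℝ}
    {e₁ e₂ d₀ d₁ : ℝ → H →L[ℝ] ℝ} {e₀ : ℝ → H →L[ℝ] ℝ} {U U₁ : ℝ → H} (hτ : 0 ≤ τ)
    (he₀ : IsEvaluation e₀) (he₁ : IsEvaluation e₁) (he₂ : IsEvaluation e₂)
    (hd₀ : IsEvaluation d₀) (hd₁ : IsEvaluation d₁)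
    (he₁₂ : ∀ F x, HasDerivAt (fun x => e₁ x F) (e₂ x F) x)
    (hd₀₁ : ∀ F x, HasDerivAt (fun x => d₀ x F) (d₁ x F) x)
    (hU : ContinuousOn U (Icc 0 τ)) (hU₁ : ∀ t ∈ Ioo 0 τ, HasDerivAt U₁ (deriv U₁ t) t)
    (r₀ : ∀ t ∈ Icc 0 τ, ∀ x, u t x = e₀ x (U t)) (r₀' : ∀ t ∈ Icc 0 τ, ∀ x, u t x = d₀ x (U₁ t))
    (hux : ∀ t ∈ Icc 0 τ, ∀ x, HasDerivAt (u t) (e₁ x (U t)) x)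
    (heq : ∀ t ∈ Ioo 0 τ, SatisfiesEquationAt k₁ k₂ k₃ u t) :
    IsClassicalSolution k₁ k₂ k₃ τ (fun t => u (projIcc 0 τ hτ t))
      (fun t x => e₁ x (U (projIcc 0 τ hτ t)))
      (fun t x => u (projIcc 0 τ hτ t) x - e₂ x (U (projIcc 0 τ hτ t)))
      (fun t x => d₀ x (deriv U₁ t)) (fun t x => d₁ x (deriv U₁ t)) := by
  obtain ⟨cl, hcl⟩ : ∃ cl : ℝ → ℝ, cl = fun t => (projIcc 0 τ hτ t : ℝ) := ⟨_, rfl⟩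
  have hcl' : ∀ t, (projIcc 0 τ hτ t : ℝ) = cl t := fun t => by rw [hcl]
  have ccl : Continuous cl := hcl ▸ continuous_subtype_val.comp continuous_projIcc
  have hclm : ∀ t, cl t ∈ Icc 0 τ := fun t => by rw [hcl]; exact (projIcc 0 τ hτ t).2
  have hcle : ∀ t ∈ Icc 0 τ, cl t = t := fun t ht => by simp only [hcl, projIcc_of_mem _ ht]
  have hclt : ∀ t ∈ Ioo 0 τ, cl t = t := fun t ht => hcle t (Ioo_subset_Icc_self ht)
  have hev : ∀ t ∈ Ioo 0 τ, ∀ᶠ r in 𝓝 t, cl r = r := fun t ht => by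
    filter_upwards [Icc_mem_nhds ht.1 ht.2] with r hr using hcle r hr
  simp only [hcl']
  have hUcl : Continuous fun t => U (cl t) := hU.comp_continuous ccl hclm
  have joint : ∀ {ev : ℝ → H →L[ℝ] ℝ}, IsEvaluation ev →
      Continuous fun p : ℝ × ℝ => ev p.2 (U (cl p.1)) := fun h => by
    obtain ⟨C, hC⟩ := h.bounded
    exact (continuous_eval_of_norm_le hC h.continuous).comp
      ((hUcl.comp continuous_fst).prodMk continuous_snd)
  have cu : Continuous fun p : ℝ × ℝ => u (cl p.1) p.2 :=
    (joint he₀).congr fun p => (r₀ _ (hclm _) _).symm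
  have cm : Continuous fun p : ℝ × ℝ => u (cl p.1) p.2 - e₂ p.2 (U (cl p.1)) := cu.sub (joint he₂)
  have r₁ : ∀ t ∈ Icc 0 τ, ∀ x, e₁ x (U t) = d₁ x (U₁ t) := fun t ht x =>
    (hux t ht x).unique ((hd₀₁ (U₁ t) x).congr_of_eventuallyEq (Eventually.of_forall (r₀' t ht)))
  have alongu : ∀ t ∈ Ioo 0 τ, ∀ (q : ℝ → ℝ) (v : ℝ), HasDerivAt q v t →
      HasDerivAt (fun r => u (cl r) (q r)) (d₀ (q t) (deriv U₁ t) + e₁ (q t) (U (cl t)) * v) t := by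
    intro t ht q v hq
    obtain ⟨C, hC⟩ := hd₀.bounded
    have htI := Ioo_subset_Icc_self ht
    have hx : HasDerivAt (fun x => d₀ x (U₁ t)) (e₁ (q t) (U (cl t))) (q t) := by
      rw [hclt t ht, r₁ t htI]
      exact hd₀₁ (U₁ t) (q t)
    refine (hasDerivAt_eval_comp hC hd₀.continuous (hU₁ t ht) hx hq).congr_of_eventuallyEq ?_
    filter_upwards [Icc_mem_nhds ht.1 ht.2] with r hr
    rw [hcle r hr, r₀' r hr]
  have alongux : ∀ t ∈ Ioo 0 τ, ∀ (q : ℝ → ℝ) (v : ℝ), HasDerivAt q v t →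
      HasDerivAt (fun r => e₁ (q r) (U (cl r)))
        (d₁ (q t) (deriv U₁ t) + e₂ (q t) (U (cl t)) * v) t := by
    intro t ht q v hq
    obtain ⟨C, hC⟩ := hd₁.bounded
    have htI := Ioo_subset_Icc_self ht
    have hx : HasDerivAt (fun x => d₁ x (U₁ t)) (e₂ (q t) (U (cl t))) (q t) := by
      rw [hclt t ht]
      exact (he₁₂ (U t) (q t)).congr_of_eventuallyEq
        (Eventually.of_forall fun x => (r₁ t htI x).symm)
    refine (hasDerivAt_eval_comp hC hd₁.continuous (hU₁ t ht) hx hq).congr_of_eventuallyEq ?_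
    filter_upwards [Icc_mem_nhds ht.1 ht.2] with r hr
    rw [hcle r hr, r₁ r hr]
  refine ⟨cu, joint he₁, cm, ?_, fun t x => hux _ (hclm t) x, fun t x => ?_, fun t => ?_,
    fun t x => hd₀₁ _ x, alongu, fun t ht q v hq => ?_, fun t ht x => ?_⟩
  · obtain ⟨B, hB⟩ := isCompact_Icc.exists_bound_of_continuousOn hU
    obtain ⟨D₀, hD₀, h0⟩ := he₀.exists_bound B
    obtain ⟨D₁, hD₁, h1⟩ := he₁.exists_bound B
    obtain ⟨D₂, hD₂, h2⟩ := he₂.exists_bound B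
    refine ⟨D₀ + D₁ + D₂, fun t x => ?_⟩
    have q0 := h0 _ x (hB _ (hclm t))
    rw [← r₀ _ (hclm t)] at q0
    have q1 := h1 _ x (hB _ (hclm t))
    have q2 := h2 _ x (hB _ (hclm t))
    exact ⟨by linarith, by linarith, (abs_sub _ _).trans (by linarith)⟩
  · rw [sub_sub_cancel]
    exact he₁₂ _ x
  · obtain ⟨D₀, hD₀, h0⟩ := hd₀.exists_bound ‖deriv U₁ t‖
    obtain ⟨D₁, hD₁, h1⟩ := hd₁.exists_bound ‖deriv U₁ t‖
    exact ⟨D₀ + D₁, fun x => ⟨(h0 _ x le_rfl).trans (by linarith),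
      (h1 _ x le_rfl).trans (by linarith)⟩⟩
  · rw [sub_sub_cancel]
    exact alongux t ht q v hq
  · have htI := Ioo_subset_Icc_self ht
    simp only [hclt t ht]
    refine (heq t ht).hasDerivAt (hux t htI) (fun x => ?_) ?_ (fun x => ?_)
      (fun x => hd₀₁ _ x) (hd₁.continuous _) x
    · rw [sub_sub_cancel]
      exact he₁₂ _ x
    · have := cm.comp (Continuous.prodMk_right t)
      simpa only [hclt t ht, Function.comp_def] using this
    · have := alongu t ht (fun _ => x) 0 (hasDerivAt_const _ _)
      rw [mul_zero, add_zero] at this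
      refine this.congr_of_eventuallyEq ?_
      filter_upwards [hev t ht] with r hr
      rw [hr]

end

/-- A strong solution is a classical solution, in the sense of `IsClassicalSolution`, on every
compact subinterval of its lifespan. -/
theorem IsStrongSolution.exists_isClassicalSolution {k₁ k₂ k₃ s : ℝ} {u₀ : ℝ → ℝ}
    {u : ℝ → ℝ → ℝ} {T : ℝ≥0∞} (hu : IsStrongSolution k₁ k₂ k₃ s u₀ u T) (hs : 5 / 2 < s) {τ : ℝ}
    (hτ : 0 < τ) (hτT : ENNReal.ofReal τ < T) :
    ∃ v vx m vt vtx : ℝ → ℝ → ℝ, IsClassicalSolution k₁ k₂ k₃ τ v vx m vt vtx ∧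
      (∀ x, v 0 x = u₀ x) ∧ (∀ x, vx 0 x = deriv u₀ x) ∧ ∀ x, m 0 x = momentum u₀ x := by
  obtain ⟨U, hUc, hU⟩ := hu.continuous
  obtain ⟨U₁, hU₁c, hU₁⟩ := hu.contDiff
  have hsub : Icc 0 τ ⊆ timeInterval T := fun t ht =>
    ⟨ht.1, (ENNReal.ofReal_le_ofReal ht.2).trans_lt hτT⟩
  have a0 : ((0 : ℕ) : ℝ) + 1 / 2 < s := by norm_num; linarith
  have a1 : ((0 + 1 : ℕ) : ℝ) + 1 / 2 < s := by norm_num; linarith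
  have a2 : ((0 + 1 + 1 : ℕ) : ℝ) + 1 / 2 < s := by norm_num; linarith
  have b0 : ((0 : ℕ) : ℝ) + 1 / 2 < s - 1 := by norm_num; linarith
  have b1 : ((0 + 1 : ℕ) : ℝ) + 1 / 2 < s - 1 := by norm_num; linarith
  have S := isClassicalSolution_of_isEvaluation hτ.le (isEvaluation_besselEvalCLM a0)
    (isEvaluation_besselEvalCLM a1) (isEvaluation_besselEvalCLM a2)
    (isEvaluation_besselEvalCLM b0) (isEvaluation_besselEvalCLM b1)
    (hasDerivAt_besselEvalCLM a1 a2) (hasDerivAt_besselEvalCLM b0 b1) (hUc.mono hsub)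
    (fun t ht => ((hU₁c.contDiffAt (mem_of_superset (Icc_mem_nhds ht.1 ht.2) hsub)).differentiableAt
      one_ne_zero).hasDerivAt)
    (fun t ht => (hU t (hsub ht)).eq_besselEvalCLM a0)
    (fun t ht => (hU₁ t (hsub ht)).eq_besselEvalCLM b0)
    (fun t ht => (hU t (hsub ht)).hasDerivAt a0 a1)
    (fun t ht => hu.equation t (hsub (Ioo_subset_Icc_self ht)) ht.1)
  have hp : ((projIcc 0 τ hτ.le 0 : Icc 0 τ) : ℝ) = 0 := by
    rw [projIcc_of_mem hτ.le ⟨le_rfl, hτ.le⟩]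
  have e0 : ∀ x, u (projIcc 0 τ hτ.le 0 : Icc 0 τ) x = u₀ x := fun x => by rw [hp, hu.initial]
  have e1 : ∀ x, besselEvalCLM a1 x (U (projIcc 0 τ hτ.le 0 : Icc 0 τ)) = deriv u₀ x := fun x => by
    have := S.hasDerivAt_u 0 x
    rw [funext e0] at this
    exact this.deriv.symm
  refine ⟨_, _, _, _, _, S, e0, e1, fun x => ?_⟩
  have := S.hasDerivAt_ux 0 x
  rw [funext e1] at this
  rw [momentum, this.deriv, sub_sub_cancel, e0]

/-! ### The lifespan bound -/

/-- The slope condition under which solutions break down, for all values of the coefficients. -/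
theorem IsStrongSolution.lt_top_and_toReal_le {k₁ k₂ k₃ s : ℝ} {u₀ : ℝ → ℝ} {u : ℝ → ℝ → ℝ}
    {T : ℝ≥0∞} (hu : IsStrongSolution k₁ k₂ k₃ s u₀ u T) (hk₁ : 0 < k₁) (hk₂ : 0 ≤ k₂)
    (hk₃ : 0 ≤ k₃) (hs : 5 / 2 < s) (hm₀ : ∀ x, 0 ≤ momentum u₀ x) {x₀ : ℝ}
    (hx₀ : 0 < momentum u₀ x₀)
    (hsteep : 0 ≤ u₀ x₀ → deriv u₀ x₀ < -(1 / √2 * √((2 * k₁ + 3 * k₂) / (2 * k₁))) *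
      (u₀ x₀ + 3 * k₃ / (2 * (2 * k₁ + 3 * k₂)))) :
    T < ⊤ ∧ T.toReal ≤ -(1 / (2 * k₁ * momentum u₀ x₀ * deriv u₀ x₀)) := by
  set κ := 1 / √2 * √((2 * k₁ + 3 * k₂) / (2 * k₁)) with hκ
  set c := 3 * k₃ / (2 * (2 * k₁ + 3 * k₂)) with hc
  have hκ0 : 0 ≤ κ := by positivity
  have hκ2 : 4 * k₁ * κ ^ 2 = 2 * k₁ + 3 * k₂ := by
    rw [hκ, mul_pow, div_pow, Real.sq_sqrt (by positivity), Real.sq_sqrt (by positivity)]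
    field_simp
    ring
  have hc0 : 0 ≤ c := by positivity
  have hc2 : 2 * (2 * k₁ + 3 * k₂) * c = 3 * k₃ := by
    rw [hc]; field_simp
  have hu₀ : |deriv u₀ x₀| ≤ u₀ x₀ := by
    obtain ⟨τ, hτ0, hτ1, hτ2⟩ := ENNReal.lt_iff_exists_real_btwn.1 hu.pos
    have hτ : 0 < τ := by simpa using hτ1
    obtain ⟨v, vx, m, vt, vtx, S, h1, h2, h3⟩ := hu.exists_isClassicalSolution hs hτ hτ2
    have := S.abs_ux_le (t := 0) (fun x => by rw [h3]; exact hm₀ x) x₀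
    rwa [h1, h2] at this
  have hst := hsteep ((abs_nonneg _).trans hu₀)
  have hneg : deriv u₀ x₀ < 0 := by
    have : 0 ≤ κ * (u₀ x₀ + c) := mul_nonneg hκ0 (add_nonneg ((abs_nonneg _).trans hu₀) hc0)
    linarith
  set T₀ := -(1 / (2 * k₁ * momentum u₀ x₀ * deriv u₀ x₀)) with hT₀
  have hT₀pos : 0 < T₀ := by
    rw [hT₀, neg_pos, one_div, inv_lt_zero]
    exact mul_neg_of_pos_of_neg (by positivity) hneg
  have hle : T ≤ ENNReal.ofReal T₀ := by
    by_contra! hlt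
    obtain ⟨v, vx, m, vt, vtx, S, h1, h2, h3⟩ := hu.exists_isClassicalSolution hs hT₀pos hlt
    have := S.lt_of_steep (κ := κ) (c := c) hk₁ hk₂ hk₃ hκ0 hκ2 hc0 hc2 hT₀pos
      (fun x => by rw [h3]; exact hm₀ x) (x₀ := x₀) (by rw [h3]; exact hx₀)
      (by rw [h1, h2]; exact hst)
    rw [h2, h3] at this
    exact lt_irrefl _ this
  exact ⟨hle.trans_lt ENNReal.ofReal_lt_top, ENNReal.toReal_le_of_le_ofReal hT₀pos.le hle⟩

end MCHNovikovCH

end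

/-- The shift in the first of the four cases is at least the one used for general coefficients. -/
theorem MCHNovikovCH.shift_le_of_case_one {k₁ k₂ k₃ γ : ℝ} (hk₁ : 0 < k₁) (hk₂ : 0 < k₂)
    (hk₃ : 0 < k₃)
    (hγ : γ = ((3 * k₂ * k₃ + 4 * k₁ * k₃)
          + 2 * k₃ * Real.sqrt (4 * k₁ ^ 2 + 6 * k₁ * k₂)) / (3 * k₂ ^ 2) ∨
      γ = ((3 * k₂ * k₃ + 4 * k₁ * k₃)
          - 2 * k₃ * Real.sqrt (4 * k₁ ^ 2 + 6 * k₁ * k₂)) / (3 * k₂ ^ 2)) :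
    3 * k₃ / (2 * (2 * k₁ + 3 * k₂)) ≤ (3 * k₂ * γ + 3 * k₃) / (2 * (2 * k₁ + 3 * k₂)) := by
  have hγ0 : 0 ≤ γ := by
    have hsq : Real.sqrt (4 * k₁ ^ 2 + 6 * k₁ * k₂) ≤ (3 * k₂ + 4 * k₁) / 2 :=
      Real.sqrt_le_iff.2 ⟨by positivity, by nlinarith [sq_nonneg k₂]⟩
    rcases hγ with rfl | rfl
    · positivity
    · refine div_nonneg ?_ (by positivity)
      have := mul_le_mul_of_nonneg_left hsq (by positivity : 0 ≤ 2 * k₃)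
      linarith
  gcongr
  have : 0 ≤ 3 * k₂ * γ := by positivity
  linarith

theorem mainTheorem7 (k₁ k₂ k₃ s : ℝ) (hk₁ : 0 < k₁) (hk₂ : 0 ≤ k₂) (hk₃ : 0 ≤ k₃)
    (hs : 5 / 2 < s) (u₀ : ℝ → ℝ) (hu₀ : MCHNovikovCH.InSobolev s u₀)
    (hm₀ : ∀ x, 0 ≤ MCHNovikovCH.momentum u₀ x)
    (x₀ : ℝ) (hx₀ : 0 < MCHNovikovCH.momentum u₀ x₀)
    (hcase :
      -- Case 1
      (0 < k₂ ∧ 0 < k₃ ∧ ∃ α γ : ℝ, 2 + 4 * k₁ / (3 * k₂) < α ∧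
        (γ = ((3 * k₂ * k₃ + 4 * k₁ * k₃)
              + 2 * k₃ * Real.sqrt (4 * k₁ ^ 2 + 6 * k₁ * k₂)) / (3 * k₂ ^ 2) ∨
          γ = ((3 * k₂ * k₃ + 4 * k₁ * k₃)
              - 2 * k₃ * Real.sqrt (4 * k₁ ^ 2 + 6 * k₁ * k₂)) / (3 * k₂ ^ 2)) ∧
        deriv u₀ x₀ < -(α / Real.sqrt 2) * Real.sqrt ((2 * k₁ + 3 * k₂) / (2 * k₁)) *
          (u₀ x₀ + (3 * k₂ * γ + 3 * k₃) / (2 * (2 * k₁ + 3 * k₂)))) ∨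
      -- Case 2
      (k₂ = 0 ∧ 0 < k₃ ∧
        deriv u₀ x₀ < -(1 / Real.sqrt 2) * (u₀ x₀ + 3 * k₃ / (4 * k₁))) ∨
      -- Case 3
      (0 < k₂ ∧ k₃ = 0 ∧
        deriv u₀ x₀ < -(1 / Real.sqrt 2) * Real.sqrt ((2 * k₁ + 3 * k₂) / (2 * k₁)) * u₀ x₀) ∨
      -- Case 4
      (k₂ = 0 ∧ k₃ = 0 ∧ deriv u₀ x₀ < -(1 / Real.sqrt 2) * u₀ x₀))
    (u : ℝ → ℝ → ℝ) (T : ℝ≥0∞) (hu : MCHNovikovCH.IsMaximalSolution k₁ k₂ k₃ s u₀ u T) :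
    T < ⊤ ∧ T.toReal ≤ -(1 / (2 * k₁ * MCHNovikovCH.momentum u₀ x₀ * deriv u₀ x₀)) := by
  refine hu.1.lt_top_and_toReal_le hk₁ hk₂ hk₃ hs hm₀ hx₀ fun hu₀x => ?_
  rcases hcase with ⟨h₂, h₃, α, γ, hα, hγ, h⟩ | ⟨rfl, h₃, h⟩ | ⟨h₂, rfl, h⟩ | ⟨rfl, rfl, h⟩
  · refine h.trans_le ?_
    have hα1 : 1 ≤ α := by
      have : 0 ≤ 4 * k₁ / (3 * k₂) := by positivity
      linarith
    have hshift := MCHNovikovCH.shift_le_of_case_one hk₁ h₂ h₃ hγ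
    have hc : 0 ≤ u₀ x₀ + 3 * k₃ / (2 * (2 * k₁ + 3 * k₂)) := by positivity
    rw [neg_mul, neg_mul, neg_mul, neg_le_neg_iff]
    gcongr
  · have e1 : (2 * k₁ + 3 * 0) / (2 * k₁) = 1 := by field_simp; ring
    have e2 : 3 * k₃ / (2 * (2 * k₁ + 3 * 0)) = 3 * k₃ / (4 * k₁) := by congr 1; ring
    rw [e1, e2, Real.sqrt_one, mul_one]
    exact h
  · rw [mul_zero, zero_div, add_zero, ← neg_mul]
    exact h
  · have e1 : (2 * k₁ + 3 * 0) / (2 * k₁) = 1 := by field_simp; ring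
    rw [e1, Real.sqrt_one, mul_one, mul_zero, zero_div, add_zero]
    exact h
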